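/- Let $\alpha=\frac{\sqrt5-1}{2}$. For $V>0$ and $\omega\in\mathbb T=\mathbb R/\mathbb Z$ let $H_{V,\omega}$ be the Fibonacci Hamiltonian, the bounded self-adjoint operator on $\ell^2(\mathbb Z)$ given by $$[H_{V,\omega}\psi](n)=\psi(n+1)+\psi(n-1)+V\chi_{[1-\alpha,1)}(n\alpha+\omega \bmod 1)\,\psi(n).$$ Its spectrum does not depend on $\omega$ and is denoted by $\Sigma_V$. For $n,m\in\mathbb Z$ and $E\in\mathbb R$ let $M(n,m,\omega,E)\in\mathrm{SL}(2,\mathbb R)$ be the transfer matrix, that is, the matrix that maps $(u(m+1),u(m))^T$ to $(u(n+1),u(n))^T$ for every solution $u:\mathbb Z\to\mathbb R$ of the difference equation $H_{V,\omega}u=Eu$. Let $a_V$ be the largest real root of $x^3-(2+V)x-1$, and let $\|\cdot\|$ be the operator norm associated with the Euclidean norm on $\mathbb R^2$. Theorem. For every $V>0$ and every $$\zeta>\frac{\log\left[(5+2V)^{1/2}(3+V)\,a_V\right]}{\log\frac{\sqrt5+1}{2}},$$ there is a constant $C>0$ such that for every $\omega\in\mathbb T$, every $E\in\Sigma_V$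 and every integer $N\ge 1$, $$\max_{0\le|n-m|\le N}\|M(n,m,\omega,E)\|\le C N^{\zeta},$$ where the maximum is over all $n,m\in\mathbb Z$ with $|n-m|\le N$. -/

import Mathlib

open scoped ENNReal Matrix

namespace Fibonacci

noncomputable section

/-- The frequency `α = (√5 - 1) / 2`. -/
def alpha : ℝ := (√5 - 1) / 2

/-- The Fibonacci potential at coupling one, `χ_{[1-α,1)}(nα + ω mod 1)`. The phase
`ω ∈ ℝ / ℤ` is given by a real representative. -/
def pot (ω : ℝ) (n : ℤ) : ℝ :=
  (Set.Ico (1 - alpha) 1).indicator (fun _ => 1) (Int.fract (n * alpha + ω))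

lemma abs_pot_le (ω : ℝ) (n : ℤ) : |pot ω n| ≤ 1 := by
  unfold pot Set.indicator
  split_ifs <;> simp

/-- The Hilbert space `ℓ²(ℤ)`. -/
abbrev EllTwo : Type := lp (fun _ : ℤ => ℂ) 2

lemma memℓp_shift (k : ℤ) (ψ : EllTwo) : Memℓp (fun n => ψ (n + k)) 2 := by
  refine memℓp_gen ?_
  have h := (lp.memℓp ψ).summable (by norm_num)
  exact (Equiv.addRight k).summable_iff.mpr h

lemma memℓp_mul_of_le_one (v : ℤ → ℝ) (hv : ∀ n, |v n| ≤ 1) (ψ : EllTwo) :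
    Memℓp (fun n => (v n : ℂ) * ψ n) 2 := by
  refine memℓp_gen (((lp.memℓp ψ).summable (by norm_num)).of_nonneg_of_le
    (fun n => by positivity) fun n => ?_)
  refine Real.rpow_le_rpow (norm_nonneg _) ?_ (by norm_num)
  simpa using mul_le_of_le_one_left (norm_nonneg (ψ n)) (hv n)

/-- The translation `ψ ↦ ψ(· + k)` on `ℓ²(ℤ)`. -/
def shift (k : ℤ) : EllTwo →L[ℂ] EllTwo :=
  LinearMap.mkContinuous
    { toFun := fun ψ => ⟨fun n => ψ (n + k), memℓp_shift k ψ⟩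
      map_add' := fun _ _ => rfl
      map_smul' := fun _ _ => rfl } 1 (fun ψ => by
    rw [one_mul, lp.norm_eq_tsum_rpow (by norm_num), lp.norm_eq_tsum_rpow (by norm_num)]
    exact le_of_eq (congrArg (· ^ _)
      ((Equiv.addRight k).tsum_eq fun n => ‖ψ n‖ ^ (2 : ℝ≥0∞).toReal)))

/-- Multiplication by the Fibonacci potential on `ℓ²(ℤ)`. -/
def potOp (ω : ℝ) : EllTwo →L[ℂ] EllTwo :=
  LinearMap.mkContinuous
    { toFun := fun ψ => ⟨fun n => (pot ω n : ℂ) * ψ n,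
        memℓp_mul_of_le_one _ (abs_pot_le ω) ψ⟩
      map_add' := fun ψ φ => lp.ext (funext fun n => mul_add (pot ω n : ℂ) (ψ n) (φ n))
      map_smul' := fun c ψ => lp.ext (funext fun n => mul_left_comm (pot ω n : ℂ) c (ψ n)) }
    1 (fun ψ => by
      rw [one_mul]
      refine lp.norm_mono (by norm_num) fun n => ?_
      simpa using mul_le_of_le_one_left (norm_nonneg (ψ n)) (abs_pot_le ω n))

/-- The Fibonacci Hamiltonian `H_{V,ω}` as a bounded operator on `ℓ²(ℤ)`. -/
def hamiltonian (V ω : ℝ) : EllTwo →L[ℂ] EllTwo :=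
  shift 1 + shift (-1) + (V : ℂ) • potOp ω

lemma hamiltonian_apply (V ω : ℝ) (ψ : EllTwo) (n : ℤ) :
    hamiltonian V ω ψ n = ψ (n + 1) + ψ (n - 1) + V * pot ω n * ψ n := by
  rw [mul_assoc]
  rfl

/-- The real points of the spectrum of `H_{V,ω}`. (As `H_{V,ω}` is self-adjoint, this is the
whole spectrum.) -/
def spec (V ω : ℝ) : Set ℝ := {E | (E : ℂ) ∈ spectrum ℂ (hamiltonian V ω)}

/-- `u` solves the difference equation `H_{V,ω} u = E u` (no decay is required). -/
def IsSolution (V ω E : ℝ) (u : ℤ → ℝ) : Prop :=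
  ∀ n, u (n + 1) + u (n - 1) + V * pot ω n * u n = E * u n

/-- The one-step transfer matrix at site `n`. -/
def stepMatrix (V ω E : ℝ) (n : ℤ) : Matrix.SpecialLinearGroup (Fin 2) ℝ :=
  ⟨!![E - V * pot ω n, -1; 1, 0], by simp [Matrix.det_fin_two]⟩

/-- The product `T(m + k) ⋯ T(m + 1)` of `k` consecutive one-step transfer matrices. -/
def stepProd (V ω E : ℝ) (m : ℤ) : ℕ → Matrix.SpecialLinearGroup (Fin 2) ℝ
  | 0 => 1
  | k + 1 => stepMatrix V ω E (m + k + 1) * stepProd V ω E m k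

/-- The transfer matrix `M(n,m,ω,E)` from `(u(m+1), u(m))` to `(u(n+1), u(n))`, for all integers
`n` and `m`; see `transferMatrix_eq_iff`. -/
def transferMatrix (V : ℝ) (n m : ℤ) (ω E : ℝ) : Matrix.SpecialLinearGroup (Fin 2) ℝ :=
  if m ≤ n then stepProd V ω E m (n - m).toNat else (stepProd V ω E n (m - n).toNat)⁻¹

lemma stepProd_mulVec {V ω E : ℝ} {u : ℤ → ℝ} (hu : IsSolution V ω E u) (m : ℤ) (k : ℕ) :
    (stepProd V ω E m k : Matrix (Fin 2) (Fin 2) ℝ) *ᵥ ![u (m + 1), u m] =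
      ![u (m + k + 1), u (m + k)] := by
  induction k with
  | zero => simp [stepProd]
  | succ k ih =>
    have h := hu (m + k + 1)
    rw [add_sub_cancel_right] at h
    rw [stepProd, Matrix.SpecialLinearGroup.coe_mul, ← Matrix.mulVec_mulVec, ih]
    push_cast
    rw [← add_assoc m]
    ext i
    fin_cases i
    · simp [stepMatrix, Matrix.mulVec, dotProduct]
      linarith
    · simp [stepMatrix, Matrix.mulVec, dotProduct]

lemma transferMatrix_mulVec {V ω E : ℝ} {u : ℤ → ℝ} (hu : IsSolution V ω E u) (n m : ℤ) :
    (transferMatrix V n m ω E : Matrix (Fin 2) (Fin 2) ℝ) *ᵥ ![u (m + 1), u m] =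
      ![u (n + 1), u n] := by
  unfold transferMatrix
  split_ifs with h
  · have := stepProd_mulVec hu m (n - m).toNat
    rwa [Int.toNat_of_nonneg (by lia), add_sub_cancel] at this
  · have := stepProd_mulVec hu n (m - n).toNat
    rw [Int.toNat_of_nonneg (by lia), add_sub_cancel] at this
    rw [← this, Matrix.mulVec_mulVec, ← Matrix.SpecialLinearGroup.coe_mul, inv_mul_cancel]
    simp

/-- Prescribed data `(u(m+1), u(m))` extend to a solution. -/
lemma exists_solution (V ω E : ℝ) (m : ℤ) (a b : ℝ) :
    ∃ u, IsSolution V ω E u ∧ u (m + 1) = a ∧ u m = b := by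
  have key : ∀ n : ℤ, (transferMatrix V n m ω E : Matrix (Fin 2) (Fin 2) ℝ) =
      (stepMatrix V ω E n : Matrix (Fin 2) (Fin 2) ℝ) *
        (transferMatrix V (n - 1) m ω E : Matrix (Fin 2) (Fin 2) ℝ) := by
    intro n
    rw [← Matrix.SpecialLinearGroup.coe_mul]
    congr 1
    unfold transferMatrix
    rcases lt_trichotomy m n with h | h | h
    · rw [if_pos h.le, if_pos (by lia)]
      obtain ⟨k, rfl⟩ : ∃ k : ℕ, n = m + k + 1 := ⟨(n - m - 1).toNat, by lia⟩
      rw [show (m + k + 1 - m).toNat = k + 1 by lia,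
        show (m + k + 1 - 1 - m).toNat = k by lia, stepProd]
    · subst h
      rw [if_pos le_rfl, if_neg (by lia), show (m - m).toNat = 0 by lia,
        show (m - (m - 1)).toNat = 0 + 1 by lia]
      simp [stepProd]
      rfl
    · rw [if_neg (by lia), if_neg (by lia)]
      obtain ⟨k, rfl⟩ : ∃ k : ℕ, m = n + k := ⟨(m - n).toNat, by lia⟩
      rw [show (n + k - n).toNat = k by lia,
        show (n + k - (n - 1)).toNat = k + 1 by lia]
      have h2 : ∀ j : ℕ, stepProd V ω E (n - 1) (j + 1) =
          stepProd V ω E n j * stepMatrix V ω E n := by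
        intro j
        induction j with
        | zero => simp [stepProd]
        | succ j ih =>
          rw [stepProd, ih, stepProd, mul_assoc]
          congr 2
          push_cast
          ring
      rw [h2, mul_inv_rev, mul_inv_cancel_left]
  set P : ℤ → Matrix (Fin 2) (Fin 2) ℝ := fun n => transferMatrix V n m ω E with hP
  have hlow : ∀ n, (P n *ᵥ ![a, b]) 1 = (P (n - 1) *ᵥ ![a, b]) 0 := by
    intro n
    simp only [hP]
    rw [key n, ← Matrix.mulVec_mulVec]
    simp [stepMatrix, Matrix.mulVec, dotProduct]
  have hup : ∀ n, (P n *ᵥ ![a, b]) 0 = (E - V * pot ω n) * (P (n - 1) *ᵥ ![a, b]) 0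
      - (P (n - 1) *ᵥ ![a, b]) 1 := by
    intro n
    simp only [hP]
    rw [key n, ← Matrix.mulVec_mulVec]
    simp [stepMatrix, Matrix.mulVec, dotProduct]
    ring
  have hm : P m = 1 := by simp [hP, transferMatrix, stepProd]
  refine ⟨fun n => (P n *ᵥ ![a, b]) 1, fun n => ?_, ?_, ?_⟩
  · have h1 := hlow (n + 1)
    rw [add_sub_cancel_right] at h1
    have h2 := hup n
    have h3 := hlow n
    simp only [h1, h2, h3]
    ring
  · have h1 := hlow (m + 1)
    rw [add_sub_cancel_right, hm] at h1
    simpa using h1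
  · simp [hm]

/-- `transferMatrix` is the unique matrix that maps `(u(m+1), u(m))` to `(u(n+1), u(n))` for every
solution `u`. -/
theorem transferMatrix_eq_iff (V ω E : ℝ) (n m : ℤ) (M : Matrix (Fin 2) (Fin 2) ℝ) :
    (transferMatrix V n m ω E : Matrix (Fin 2) (Fin 2) ℝ) = M ↔
      ∀ u, IsSolution V ω E u → M *ᵥ ![u (m + 1), u m] = ![u (n + 1), u n] := by
  refine ⟨?_, fun h => ?_⟩
  · rintro rfl u hu
    exact transferMatrix_mulVec hu n m
  · refine Matrix.mulVec_injective (funext fun x => ?_)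
    obtain ⟨u, hu, h1, h0⟩ := exists_solution V ω E m (x 0) (x 1)
    have hx : x = ![u (m + 1), u m] := by
      ext i
      fin_cases i <;> simp [h0, h1]
    rw [hx, transferMatrix_mulVec hu, h u hu]

/-- The operator norm of a `2 × 2` real matrix with respect to the Euclidean norm on `ℝ²`. -/
def opNorm (M : Matrix (Fin 2) (Fin 2) ℝ) : ℝ :=
  ‖Matrix.toEuclideanCLM (n := Fin 2) (𝕜 := ℝ) M‖

/-- The largest real root `a_V` of `x³ - (2 + V) x - 1`; see `isGreatest_largestRoot`. -/
def largestRoot (V : ℝ) : ℝ := sSup {x : ℝ | x ^ 3 - (2 + V) * x - 1 = 0}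

lemma isGreatest_largestRoot {V : ℝ} (hV : 0 < V) :
    IsGreatest {x : ℝ | x ^ 3 - (2 + V) * x - 1 = 0} (largestRoot V) := by
  have hb : BddAbove {x : ℝ | x ^ 3 - (2 + V) * x - 1 = 0} := by
    refine ⟨3 + V, fun x hx => ?_⟩
    by_contra! hlt
    simp only [Set.mem_ofPred_eq] at hx
    nlinarith [mul_pos (sub_pos.2 hlt) (sub_pos.2 hlt), mul_pos hV (sub_pos.2 hlt),
      mul_pos (mul_pos hV (sub_pos.2 hlt)) (sub_pos.2 hlt),
      mul_pos (mul_pos (sub_pos.2 hlt) (sub_pos.2 hlt)) (sub_pos.2 hlt),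
      mul_pos (mul_pos hV hV) (sub_pos.2 hlt)]
  have hc : IsClosed {x : ℝ | x ^ 3 - (2 + V) * x - 1 = 0} :=
    isClosed_eq (by fun_prop) continuous_const
  have hne : {x : ℝ | x ^ 3 - (2 + V) * x - 1 = 0}.Nonempty := by
    have h := intermediate_value_Icc' (f := fun x : ℝ => x ^ 3 - (2 + V) * x - 1)
      (show (-1 : ℝ) ≤ 0 by norm_num) (by fun_prop)
    obtain ⟨x, -, hx⟩ := h (show (0 : ℝ) ∈ _ by constructor <;> norm_num; linarith)
    exact ⟨x, hx⟩
  exact ⟨hc.csSup_mem hne hb, fun x hx => le_csSup hb hx⟩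

end

end Fibonacci

namespace Fibonacci

/-! A transfer matrix is a product over a factor of the Fibonacci word, and long factors are almost
periodic with Fibonacci periods. By Cayley–Hamilton, `A U B = tr U • A B - A U⁻¹ B`; when `U` is a
suitable period block, `A B` and `A U⁻¹ B` belong to shorter factors or their inverses. With `|tr U|
≤ 2 + V`, raising the length bound from one Fibonacci number to the next costs a factor `3 + V`
(`entrySum_stepProd_succ_level`). Since `φ ^ k ≤ fib (k + 2)`, with `φ` the golden ratio, this gives
the exponent `log (3 + V) / log φ`, which is at most the stated one (`three_add_le`).

Two inputs are needed. The combinatorial one is that periodicity with period `fib (k + 1)` fails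
only at `Bad k` sites: those of consecutive levels are far apart (`Bad.separated`), and all period
blocks but those starting at a bad site have the trace of the standard word (`slTrace_stepProd`).

The spectral one is the trace bound on the spectrum. If two consecutive traces exceed 2 in absolute
value, the traces escape near `E`, so no large periodic approximant has an eigenvalue there. A
cutoff argument then makes `H - E` bounded below and hence invertible (`not_mem_spec`). On the
spectrum, each trace exceeding 2 in absolute value therefore has neighbours at most 2, and the
Fricke–Vogt invariant gives `2 + V` (`abs_slTrace_wordMatrix_le`). -/

lemma alpha_sq : alpha ^ 2 = 1 - alpha := by
  have h : (√5) ^ 2 = 5 := Real.sq_sqrt (by norm_num)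
  unfold alpha
  nlinarith

lemma alpha_pos : 0 < alpha := by
  have h : 1 < √5 := by rw [Real.lt_sqrt] <;> norm_num
  unfold alpha
  linarith

lemma alpha_lt_one : alpha < 1 := by nlinarith [alpha_sq, alpha_pos]

/-! ### Rotation orbit, near-periods and bad sites -/

/-- The value at `n` of the lift of the rotation orbit, rounded down. -/
noncomputable def height (ω : ℝ) (n : ℤ) : ℤ := ⌊(n : ℝ) * alpha + ω⌋

lemma pot_eq_height_sub (ω : ℝ) (n : ℤ) :
    pot ω n = ((height ω (n + 1) - height ω n : ℤ) : ℝ) := by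
  unfold pot height
  set x : ℝ := n * alpha + ω with hx
  have h1 : ((n + 1 : ℤ) : ℝ) * alpha + ω = x + alpha := by push_cast; ring
  rw [h1]
  have hf := Int.fract_add_floor x
  have h0 := Int.fract_nonneg x
  have h2 := Int.fract_lt_one x
  by_cases h : 1 - alpha ≤ Int.fract x
  · rw [Set.indicator_of_mem (Set.mem_Ico.2 ⟨h, h2⟩)]
    have : ⌊x + alpha⌋ = ⌊x⌋ + 1 := by
      rw [Int.floor_eq_iff]
      push_cast
      constructor <;> linarith [alpha_lt_one]
    simp [this]
  · rw [Set.indicator_of_notMem (fun hm => h hm.1)]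
    have : ⌊x + alpha⌋ = ⌊x⌋ := by
      rw [Int.floor_eq_iff]
      constructor <;> linarith [alpha_pos]
    simp [this]

lemma fib_mul_alpha_sub (k : ℕ) :
    (Nat.fib (k + 1) : ℝ) * alpha - Nat.fib k = (-1) ^ k * alpha ^ (k + 1) := by
  induction k using Nat.twoStepInduction with
  | zero => simp
  | one => simp; linarith [alpha_sq]
  | more k h1 h2 =>
    have e1 : (Nat.fib (k + 3) : ℝ) = Nat.fib (k + 1) + Nat.fib (k + 2) := by
      exact_mod_cast Nat.fib_add_two (n := k + 1)
    have e2 : (Nat.fib (k + 2) : ℝ) = Nat.fib k + Nat.fib (k + 1) := by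
      exact_mod_cast Nat.fib_add_two (n := k)
    have h2' : (Nat.fib (k + 2) : ℝ) * alpha - Nat.fib (k + 1) =
      (-1) ^ (k + 1) * alpha ^ (k + 2) := h2
    have e3 : alpha ^ (k + 3) = alpha ^ (k + 1) - alpha ^ (k + 2) := by
      rw [pow_succ, pow_succ alpha (k + 1), pow_succ alpha k]
      linear_combination (alpha ^ k * alpha) * alpha_sq
    show (Nat.fib (k + 3) : ℝ) * alpha - Nat.fib (k + 2) = (-1) ^ (k + 2) * alpha ^ (k + 3)
    rw [e1, e3, pow_succ _ (k + 1), pow_succ]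
    rw [pow_succ] at h2'
    nlinarith

/-- Sites where the translation by `fib (k + 1)` does not act on `height` as on multiples of the
convergent `fib k / fib (k + 1)`. -/
def Bad (k : ℕ) (ω : ℝ) (n : ℤ) : Prop :=
  height ω (n + Nat.fib (k + 1)) ≠ height ω n + Nat.fib k

lemma pot_add_fib {k : ℕ} {ω : ℝ} {n : ℤ} (h0 : ¬ Bad k ω n) (h1 : ¬ Bad k ω (n + 1)) :
    pot ω (n + Nat.fib (k + 1)) = pot ω n := by
  rw [Bad, not_not] at h0 h1
  rw [pot_eq_height_sub, pot_eq_height_sub, add_right_comm, h1, h0]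
  congr 1
  ring

lemma height_add_fib_arg (k : ℕ) (ω : ℝ) (n : ℤ) :
    ((n + Nat.fib (k + 1) : ℤ) : ℝ) * alpha + ω =
      (n * alpha + ω + (-1) ^ k * alpha ^ (k + 1)) + (Nat.fib k : ℤ) := by
  rw [← fib_mul_alpha_sub]
  push_cast
  ring

/-- Modulo `fib k`, the translation moves the orbit point by `(-1) ^ k * alpha ^ (k + 1)`. The floor
reacts only if the point is that close to an integer, on the side selected by the sign. -/
lemma Bad.exists_int {k : ℕ} {ω : ℝ} {n : ℤ} (h : Bad k ω n) :
    ∃ z : ℤ, ((-1 : ℝ) ^ k = 1 ∧ -alpha ^ (k + 1) ≤ n * alpha + ω - z ∧ n * alpha + ω - z < 0) ∨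
      ((-1 : ℝ) ^ k = -1 ∧ 0 ≤ n * alpha + ω - z ∧ n * alpha + ω - z < alpha ^ (k + 1)) := by
  have hδ : 0 < alpha ^ (k + 1) := pow_pos alpha_pos _
  unfold Bad height at h
  rw [height_add_fib_arg, Int.floor_add_intCast, Ne, add_left_inj] at h
  set x : ℝ := n * alpha + ω
  have hx := Int.floor_le x
  have hx' := Int.lt_floor_add_one x
  rcases neg_one_pow_eq_or ℝ k with hk | hk
  · refine ⟨⌊x⌋ + 1, Or.inl ⟨hk, ?_⟩⟩
    push_cast
    refine ⟨?_, by linarith⟩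
    by_contra! hlt
    refine h (Int.floor_eq_iff.2 ⟨?_, ?_⟩) <;> rw [hk] <;> linarith
  · refine ⟨⌊x⌋, Or.inr ⟨hk, by linarith, ?_⟩⟩
    by_contra! hlt
    refine h (Int.floor_eq_iff.2 ⟨?_, ?_⟩) <;> rw [hk] <;> linarith

/-- Consecutive convergents form a basis of `ℤ²`. -/
lemma exists_fib_combination (k : ℕ) (n z : ℤ) : ∃ a b : ℤ,
    n = a * Nat.fib (k + 1) + b * Nat.fib (k + 2) ∧ z = a * Nat.fib k + b * Nat.fib (k + 1) := by
  induction k with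
  | zero => exact ⟨n - z, z, by simp, by simp⟩
  | succ k ih =>
    obtain ⟨a, b, h1, h2⟩ := ih
    refine ⟨b - a, a, ?_, ?_⟩
    · rw [Nat.fib_add_two (n := k + 1), h1]; push_cast; ring
    · rw [Nat.fib_add_two (n := k), h2]; push_cast; ring

lemma exists_fib_combination_real (k : ℕ) (n z : ℤ) : ∃ a b : ℤ,
    n = a * Nat.fib (k + 1) + b * Nat.fib (k + 2) ∧
      n * alpha - z = (-1) ^ k * (a * alpha ^ (k + 1) - b * alpha ^ (k + 2)) := by
  obtain ⟨a, b, h1, h2⟩ := exists_fib_combination k n z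
  refine ⟨a, b, h1, ?_⟩
  have e1 := fib_mul_alpha_sub k
  have e2 := fib_mul_alpha_sub (k + 1)
  rw [h1, h2]
  push_cast
  rw [pow_succ] at e2
  linear_combination (a : ℝ) * e1 + (b : ℝ) * e2

/-- Bad sites of consecutive levels are far apart. -/
lemma Bad.separated {k : ℕ} (hk : 1 ≤ k) {ω : ℝ} {d e : ℤ} (hd : Bad k ω d) (he : Bad (k + 1) ω e)
    (h1 : d - e ≤ Nat.fib (k + 1)) (h2 : e - d < Nat.fib (k + 1)) : False := by
  obtain ⟨z, hz⟩ := hd.exists_int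
  obtain ⟨w, hw⟩ := he.exists_int
  obtain ⟨a, b, hn, hr⟩ := exists_fib_combination_real k (d - e) (z - w)
  have hδ : 0 < alpha ^ (k + 1) := pow_pos alpha_pos _
  have hδ' : 0 < alpha ^ (k + 2) := pow_pos alpha_pos _
  have hfib : (Nat.fib (k + 1) : ℤ) < Nat.fib (k + 2) := by
    have h0 : 0 < Nat.fib k := Nat.fib_pos.2 hk
    rw [Nat.fib_add_two]; push_cast; lia
  have hpos : (0 : ℤ) < Nat.fib (k + 1) := by exact_mod_cast Nat.fib_pos.2 (by lia)
  -- Signs alternate with the level, so the two orbit points lie on opposite sides of integers and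
  -- their difference has a definite sign. Below, `0 ≤ a` forces `d - e ≥ fib (k + 2)`, and `a < 0`
  -- forces `d - e ≤ -fib (k + 1)`.
  have key : (a : ℝ) * alpha ^ (k + 1) - b * alpha ^ (k + 2) < 0 ∧
      -alpha ^ (k + 1) - alpha ^ (k + 2) < a * alpha ^ (k + 1) - b * alpha ^ (k + 2) := by
    push_cast at hr
    rw [pow_succ] at hw
    rcases hz with ⟨hs, hz1, hz2⟩ | ⟨hs, hz1, hz2⟩ <;> rw [hs] at hw hr <;> norm_num at hw <;>
      constructor <;> linarith
  rcases le_or_gt 0 a with ha | ha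
  · have ha' : (0 : ℝ) ≤ a := by exact_mod_cast ha
    have hb : 0 < b := by
      by_contra! hb
      have hb' : (b : ℝ) ≤ 0 := by exact_mod_cast hb
      nlinarith [key.1, mul_nonneg ha' hδ.le]
    nlinarith
  · have ha' : (a : ℝ) ≤ -1 := by exact_mod_cast (by lia : a ≤ -1)
    have hb : b ≤ 0 := by
      by_contra! hb
      have hb' : (1 : ℝ) ≤ b := by exact_mod_cast hb
      nlinarith [key.2]
    nlinarith

/-- Multiples of `alpha` are badly approximated by integers. -/
lemma fib_best_approx {k : ℕ} {i z : ℤ} (h0 : 0 < i) (hi : i < Nat.fib (k + 2))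
    (h1 : -alpha ^ (k + 1) ≤ (-1) ^ k * (i * alpha - z))
    (h2 : (-1) ^ k * (i * alpha - z) < alpha ^ (k + 1)) : False := by
  obtain ⟨a, b, hn, hr⟩ := exists_fib_combination_real k i z
  have hδ : 0 < alpha ^ (k + 1) := pow_pos alpha_pos _
  have hδ' : 0 < alpha ^ (k + 2) := pow_pos alpha_pos _
  have hpos : (0 : ℤ) < Nat.fib (k + 1) := by exact_mod_cast Nat.fib_pos.2 (by lia)
  have hpos' : (0 : ℤ) < Nat.fib (k + 2) := by exact_mod_cast Nat.fib_pos.2 (by lia)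
  have hs : (-1 : ℝ) ^ k * (-1) ^ k = 1 := by rw [← mul_pow]; norm_num
  rw [hr, ← mul_assoc, hs, one_mul] at h1 h2
  rcases lt_trichotomy a 0 with ha | ha | ha
  · have ha' : (a : ℝ) ≤ -1 := by exact_mod_cast (by lia : a ≤ -1)
    have hb : b ≤ 0 := by
      by_contra! hb
      have hb' : (1 : ℝ) ≤ b := by exact_mod_cast hb
      nlinarith
    nlinarith
  · have hb : 0 < b := by subst ha; nlinarith
    nlinarith
  · have ha' : (1 : ℝ) ≤ a := by exact_mod_cast ha
    have hb : 0 < b := by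
      by_contra! hb
      have hb' : (b : ℝ) ≤ 0 := by exact_mod_cast hb
      nlinarith
    nlinarith

/-- The orbit at a bad site is nearly an integer, and `fib_best_approx` keeps `i * alpha` out of the
gap where this small offset could change a floor. Hence every bad site is followed by the same
block. -/
lemma Bad.height_add {k : ℕ} {ω : ℝ} {e : ℤ} (he : Bad k ω e) :
    ∃ z : ℤ, ∀ i : ℤ, 0 < i → i < Nat.fib (k + 2) → height ω (e + i) = height 0 i + z := by
  obtain ⟨z, hz⟩ := he.exists_int
  have hδ : 0 < alpha ^ (k + 1) := pow_pos alpha_pos _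
  refine ⟨z, fun i h0 hi => ?_⟩
  unfold height
  have e1 : ((e + i : ℤ) : ℝ) * alpha + ω = (i * alpha + (e * alpha + ω - z)) + (z : ℤ) := by
    push_cast; ring
  rw [e1, Int.floor_add_intCast, add_zero, add_left_inj]
  set y : ℝ := e * alpha + ω - z
  have hx := Int.floor_le (i * alpha)
  have hx' := Int.lt_floor_add_one (i * alpha)
  rw [Int.floor_eq_iff]
  rcases hz with ⟨hs, hz1, hz2⟩ | ⟨hs, hz1, hz2⟩
  · refine ⟨?_, by linarith⟩
    by_contra! hlt
    refine fib_best_approx (k := k) (z := ⌊i * alpha⌋) h0 hi ?_ ?_ <;> rw [hs] <;> linarith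
  · refine ⟨by linarith, ?_⟩
    by_contra! hlt
    refine fib_best_approx (k := k) (z := ⌊i * alpha⌋ + 1) h0 hi ?_ ?_ <;> rw [hs] <;>
      push_cast <;> linarith

lemma Bad.pot_add {k : ℕ} {ω : ℝ} {e : ℤ} (he : Bad k ω e) {i : ℤ} (h0 : 0 < i)
    (hi : i + 1 < Nat.fib (k + 2)) : pot ω (e + i) = pot 0 i := by
  obtain ⟨z, hz⟩ := he.height_add
  rw [pot_eq_height_sub, pot_eq_height_sub, add_assoc, hz _ (by lia) hi, hz _ h0 (by lia)]
  congr 1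
  ring

lemma not_bad_zero {k : ℕ} {i : ℤ} (h0 : 0 < i) (hi : i < Nat.fib (k + 2)) : ¬ Bad k 0 i := by
  intro h
  obtain ⟨z, hz⟩ := h.exists_int
  have hδ : 0 < alpha ^ (k + 1) := pow_pos alpha_pos _
  refine fib_best_approx (k := k) (z := z) h0 hi ?_ ?_ <;>
    rcases hz with ⟨hs, hz1, hz2⟩ | ⟨hs, hz1, hz2⟩ <;> rw [hs] <;> linarith

/-- Otherwise `height` would have slope exactly `fib k / fib (k + 1)` along a left half-progression,
while the orbit drifts from that slope by `alpha ^ (k + 1)` per step, eventually by more than 1. -/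
lemma exists_bad_le (k : ℕ) (ω : ℝ) (m : ℤ) : ∃ e ≤ m, Bad k ω e := by
  by_contra! h
  have hδ : 0 < alpha ^ (k + 1) := pow_pos alpha_pos _
  have hg : ∀ i : ℕ, height ω (m - i * Nat.fib (k + 1)) = height ω m - i * Nat.fib k := by
    intro i
    induction i with
    | zero => simp
    | succ i ih =>
      have h2 := h (m - (i + 1 : ℕ) * Nat.fib (k + 1)) (by
        have : (0 : ℤ) ≤ (i + 1 : ℕ) * Nat.fib (k + 1) := by positivity
        lia)
      rw [Bad, not_not] at h2
      have e1 : m - ((i + 1 : ℕ) : ℤ) * Nat.fib (k + 1) + Nat.fib (k + 1) =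
          m - i * Nat.fib (k + 1) := by push_cast; ring
      rw [e1, ih] at h2
      push_cast at h2 ⊢
      linarith
  obtain ⟨i, hi⟩ := exists_nat_gt (1 / alpha ^ (k + 1))
  rw [div_lt_iff₀ hδ] at hi
  have h1 := hg i
  unfold height at h1
  have h2 := Int.floor_le (((m - i * Nat.fib (k + 1) : ℤ) : ℝ) * alpha + ω)
  have h3 := Int.lt_floor_add_one (((m - i * Nat.fib (k + 1) : ℤ) : ℝ) * alpha + ω)
  rw [h1] at h2 h3
  have h4 := Int.floor_le ((m : ℝ) * alpha + ω)
  have h5 := Int.lt_floor_add_one ((m : ℝ) * alpha + ω)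
  have e := fib_mul_alpha_sub k
  push_cast at h2 h3
  have e' : (i : ℝ) * (Nat.fib (k + 1) * alpha) = i * Nat.fib k +
      (-1) ^ k * (i * alpha ^ (k + 1)) := by linear_combination (i : ℝ) * e
  rcases neg_one_pow_eq_or ℝ k with hk | hk <;> rw [hk] at e' <;> nlinarith

/-! ### Period blocks and their traces -/

lemma stepProd_add (V ω E : ℝ) (m : ℤ) (j k : ℕ) :
    stepProd V ω E m (j + k) = stepProd V ω E (m + j) k * stepProd V ω E m j := by
  induction k with
  | zero => simp [stepProd]
  | succ k ih =>
    rw [← add_assoc, stepProd, ih, stepProd, mul_assoc]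
    congr 2
    push_cast
    ring

lemma stepProd_one (V ω E : ℝ) (m : ℤ) : stepProd V ω E m 1 = stepMatrix V ω E (m + 1) := by
  simp [stepProd]

lemma stepProd_congr {V ω ω' E : ℝ} {m m' : ℤ} {k : ℕ}
    (h : ∀ i : ℤ, 0 < i → i ≤ k → pot ω (m + i) = pot ω' (m' + i)) :
    stepProd V ω E m k = stepProd V ω' E m' k := by
  induction k with
  | zero => rfl
  | succ k ih =>
    rw [stepProd, stepProd, ih fun i h0 hi => h i h0 (by push_cast; lia)]
    congr 1
    have := h (k + 1) (by lia) (by push_cast; lia)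
    unfold stepMatrix
    congr 2
    rw [add_assoc, this, add_assoc]

/-- The trace of an element of `SL(2, ℝ)`. -/
noncomputable def slTrace (A : Matrix.SpecialLinearGroup (Fin 2) ℝ) : ℝ :=
  (A : Matrix (Fin 2) (Fin 2) ℝ).trace

lemma slTrace_mul_comm (A B : Matrix.SpecialLinearGroup (Fin 2) ℝ) : slTrace (A * B) = slTrace (B * A) := by
  rw [slTrace, slTrace, Matrix.SpecialLinearGroup.coe_mul, Matrix.SpecialLinearGroup.coe_mul,
    Matrix.trace_mul_comm]

/-- The Cayley–Hamilton theorem in `SL(2, ℝ)`. -/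
lemma coe_add_coe_inv (A : Matrix.SpecialLinearGroup (Fin 2) ℝ) :
    (A : Matrix (Fin 2) (Fin 2) ℝ) + (A⁻¹ : Matrix.SpecialLinearGroup (Fin 2) ℝ) = slTrace A • 1 := by
  rw [Matrix.SpecialLinearGroup.coe_inv, slTrace]
  ext i j
  fin_cases i <;> fin_cases j <;> simp [Matrix.adjugate_fin_two, Matrix.trace_fin_two, add_comm]

/-- The transfer matrices over the standard words: `s₀ = 0`, `s₁ = 1`, `s₍ₖ₊₂₎ = s₍ₖ₊₁₎ sₖ`. -/
noncomputable def wordMatrix (V E : ℝ) : ℕ → Matrix.SpecialLinearGroup (Fin 2) ℝ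
  | 0 => ⟨!![E, -1; 1, 0], by simp [Matrix.det_fin_two]⟩
  | 1 => ⟨!![E - V, -1; 1, 0], by simp [Matrix.det_fin_two]⟩
  | k + 2 => wordMatrix V E k * wordMatrix V E (k + 1)

lemma pot_zero_one : pot 0 1 = 1 := by
  have h : Int.fract alpha = alpha := Int.fract_eq_self.2 ⟨alpha_pos.le, alpha_lt_one⟩
  unfold pot
  rw [Set.indicator_of_mem]
  norm_num [h]
  exact ⟨by nlinarith [alpha_sq, alpha_pos, alpha_lt_one], alpha_lt_one⟩

lemma pot_zero_two : pot 0 2 = 0 := by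
  have h : Int.fract (2 * alpha) = 2 * alpha - 1 := by
    rw [Int.fract_eq_iff]
    exact ⟨by nlinarith [alpha_sq, alpha_pos, alpha_lt_one],
      by linarith [alpha_lt_one], 1, by norm_num⟩
  unfold pot
  rw [Set.indicator_of_notMem]
  norm_num [h]
  intro h
  nlinarith [alpha_sq, alpha_pos, alpha_lt_one]

/-- Phase zero has no level-`k` bad site strictly between `0` and `fib (k + 2)`, so the tail of each
long prefix repeats its beginning, as in the word recursion. -/
lemma stepProd_zero_eq_wordMatrix (V E : ℝ) (k : ℕ) (hk : 1 ≤ k) :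
    stepProd V 0 E 0 (Nat.fib (k + 1)) = wordMatrix V E k := by
  induction k using Nat.strong_induction_on with
  | _ k ih =>
  match k, hk with
  | 1, _ =>
    rw [show Nat.fib (1 + 1) = 1 from rfl, stepProd_one]
    simp [stepMatrix, wordMatrix, pot_zero_one]
    rfl
  | 2, _ =>
    rw [show Nat.fib (2 + 1) = 1 + 1 from rfl, stepProd_add, stepProd_one, stepProd_one]
    simp [stepMatrix, wordMatrix, pot_zero_one, pot_zero_two]
  | k + 3, _ =>
    rw [show k + 3 + 1 = (k + 2) + 2 from rfl, Nat.fib_add_two, add_comm, stepProd_add,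
      ih (k + 2) (by lia) (by lia), zero_add]
    refine congrArg (· * wordMatrix V E (k + 2)) ?_
    rw [← ih (k + 1) (by lia) (by lia)]
    refine stepProd_congr fun i h0 hi => ?_
    rw [zero_add, add_comm]
    have hf : Nat.fib (k + 2) + 1 < Nat.fib (k + 2 + 2) := by
      have h1 : 1 < Nat.fib (k + 3) := by
        have := Nat.fib_mono (show 3 ≤ k + 3 by lia)
        have h3 : Nat.fib 3 = 2 := rfl
        lia
      rw [Nat.fib_add_two (n := k + 2)]
      lia
    refine pot_add_fib (k := k + 2) ?_ ?_
    · exact not_bad_zero h0 (by lia)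
    · exact not_bad_zero (by lia) (by lia)

lemma Bad.stepProd_eq {V E : ℝ} {k : ℕ} (hk : 3 ≤ k) {ω : ℝ} {e : ℤ} (he : Bad k ω e) :
    stepProd V ω E e (Nat.fib (k + 1)) = wordMatrix V E k := by
  rw [← stepProd_zero_eq_wordMatrix V E k (by lia)]
  refine stepProd_congr fun i h0 hi => ?_
  rw [zero_add]
  refine he.pot_add h0 ?_
  -- The potential at `i` involves `height` at `i + 1`, so the block must satisfy `fib (k + 1) + 1 <
  -- fib (k + 2)`; hence `3 ≤ k`.
  have h1 : 1 < Nat.fib k := by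
    have := Nat.fib_mono hk
    have h3 : Nat.fib 3 = 2 := rfl
    lia
  rw [Nat.fib_add_two]
  push_cast
  lia

/-- The letter leaving the window equals the one entering it, so the slide is a conjugation by one
step matrix. -/
lemma slTrace_stepProd_succ {V E : ℝ} {k : ℕ} {ω : ℝ} {m : ℤ} (h1 : ¬ Bad k ω (m + 1))
    (h2 : ¬ Bad k ω (m + 2)) :
    slTrace (stepProd V ω E (m + 1) (Nat.fib (k + 1))) =
      slTrace (stepProd V ω E m (Nat.fib (k + 1))) := by
  set p := Nat.fib (k + 1) with hp
  have e1 := stepProd_add V ω E m 1 p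
  have e2 := stepProd_add V ω E m p 1
  rw [add_comm, e2, stepProd_one, stepProd_one] at e1
  have e3 : stepMatrix V ω E (m + p + 1) = stepMatrix V ω E (m + 1) := by
    have := pot_add_fib h1 (by rwa [add_assoc])
    unfold stepMatrix
    congr 2
    rw [add_right_comm, this]
  rw [e3] at e1
  have e4 : stepProd V ω E (m + 1) p =
      stepMatrix V ω E (m + 1) * (stepProd V ω E m p * (stepMatrix V ω E (m + 1))⁻¹) := by
    rw [← mul_assoc, e1]
    simp
  rw [e4, slTrace_mul_comm]
  simp

/-- All factors of length `fib (k + 1)` but one are conjugate to the standard word. -/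
lemma slTrace_stepProd {V E : ℝ} {k : ℕ} (hk : 3 ≤ k) {ω : ℝ} {m : ℤ} (h : ¬ Bad k ω (m + 1)) :
    slTrace (stepProd V ω E m (Nat.fib (k + 1))) = slTrace (wordMatrix V E k) := by
  -- The window just after the last bad site `e ≤ m` is the standard word; slide it from there to
  -- `m`.
  obtain ⟨e, ⟨hem, he⟩, hmax⟩ := Int.exists_greatest_of_bdd
    (P := fun e => e ≤ m ∧ Bad k ω e) ⟨m, fun z hz => hz.1⟩ (exists_bad_le k ω m)
  have key : ∀ j : ℕ, e + j ≤ m → slTrace (stepProd V ω E (e + j) (Nat.fib (k + 1))) =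
      slTrace (wordMatrix V E k) := by
    intro j
    induction j with
    | zero => intro _; simp [he.stepProd_eq hk]
    | succ j ih =>
      intro hj
      push_cast at hj
      rw [← ih (by lia)]
      push_cast
      rw [← add_assoc]
      refine slTrace_stepProd_succ (fun hb => ?_) (fun hb => ?_)
      · have := hmax _ ⟨by lia, hb⟩
        lia
      · rcases (show e + j + 2 ≤ m ∨ e + j + 2 = m + 1 by lia) with hc | hc
        · have := hmax _ ⟨hc, hb⟩
          lia
        · exact h (hc ▸ hb)
  have := key (m - e).toNat (by lia)
  rwa [show e + ((m - e).toNat : ℤ) = m by lia] at this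

/-! ### Trace map, invariant and escape -/

lemma slTrace_mul (A B : Matrix.SpecialLinearGroup (Fin 2) ℝ) :
    slTrace (A * B) = slTrace A * slTrace B - slTrace (A⁻¹ * B) := by
  have h := congrArg (fun M : Matrix (Fin 2) (Fin 2) ℝ => (M * B).trace) (coe_add_coe_inv A)
  simp only [add_mul, Matrix.trace_add, Matrix.smul_mul, one_mul, Matrix.trace_smul] at h
  unfold slTrace at *
  rw [Matrix.SpecialLinearGroup.coe_mul, Matrix.SpecialLinearGroup.coe_mul]
  rw [smul_eq_mul] at h
  linarith

/-- The trace map. -/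
lemma slTrace_wordMatrix_add_three (V E : ℝ) (k : ℕ) :
    slTrace (wordMatrix V E (k + 3)) =
      slTrace (wordMatrix V E (k + 2)) * slTrace (wordMatrix V E (k + 1)) -
        slTrace (wordMatrix V E k) := by
  rw [wordMatrix, slTrace_mul, mul_comm, wordMatrix, slTrace_mul_comm (wordMatrix V E (k + 1))⁻¹]
  simp

lemma slTrace_wordMatrix_zero (V E : ℝ) : slTrace (wordMatrix V E 0) = E := by
  simp [slTrace, wordMatrix, Matrix.trace_fin_two]

lemma slTrace_wordMatrix_one (V E : ℝ) : slTrace (wordMatrix V E 1) = E - V := by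
  simp [slTrace, wordMatrix, Matrix.trace_fin_two]

lemma slTrace_wordMatrix_two (V E : ℝ) : slTrace (wordMatrix V E 2) = E * (E - V) - 2 := by
  rw [slTrace, wordMatrix, Matrix.SpecialLinearGroup.coe_mul]
  simp [wordMatrix, Matrix.trace_fin_two]
  ring

/-- The Fricke–Vogt invariant. -/
lemma fricke_vogt (V E : ℝ) (k : ℕ) :
    slTrace (wordMatrix V E k) ^ 2 + slTrace (wordMatrix V E (k + 1)) ^ 2 +
      slTrace (wordMatrix V E (k + 2)) ^ 2 - slTrace (wordMatrix V E k) *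
        slTrace (wordMatrix V E (k + 1)) * slTrace (wordMatrix V E (k + 2)) - 4 = V ^ 2 := by
  induction k with
  | zero =>
    rw [zero_add, zero_add, slTrace_wordMatrix_zero, slTrace_wordMatrix_one, slTrace_wordMatrix_two]
    ring
  | succ k ih =>
    rw [slTrace_wordMatrix_add_three]
    rw [← ih]
    ring

/-- If two consecutive traces exceed two and dominate the previous one, the traces escape. -/
lemma two_lt_abs_slTrace {V E : ℝ} {k : ℕ} (h1 : 2 < |slTrace (wordMatrix V E (k + 1))|)
    (h2 : 2 < |slTrace (wordMatrix V E (k + 2))|)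
    (h0 : |slTrace (wordMatrix V E k)| <
      max |slTrace (wordMatrix V E (k + 1))| |slTrace (wordMatrix V E (k + 2))|) (j : ℕ) :
    2 < |slTrace (wordMatrix V E (k + j + 1))| := by
  suffices h : 2 < |slTrace (wordMatrix V E (k + j + 1))| ∧
      2 < |slTrace (wordMatrix V E (k + j + 2))| ∧ |slTrace (wordMatrix V E (k + j))| <
      max |slTrace (wordMatrix V E (k + j + 1))| |slTrace (wordMatrix V E (k + j + 2))| from h.1
  induction j with
  | zero => exact ⟨h1, h2, h0⟩
  | succ j ih =>
    obtain ⟨a1, a2, a0⟩ := ih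
    have h3 := slTrace_wordMatrix_add_three V E (k + j)
    rw [← add_assoc, show k + j + 1 + 1 = k + j + 2 from rfl,
      show k + j + 1 + 2 = k + j + 3 from rfl]
    have h4 : |slTrace (wordMatrix V E (k + j + 2))| * |slTrace (wordMatrix V E (k + j + 1))| -
        |slTrace (wordMatrix V E (k + j))| ≤ |slTrace (wordMatrix V E (k + j + 3))| := by
      rw [h3, ← abs_mul]
      exact abs_sub_abs_le_abs_sub _ _
    set A := |slTrace (wordMatrix V E (k + j + 1))|
    set B := |slTrace (wordMatrix V E (k + j + 2))|
    have h5 : A < |slTrace (wordMatrix V E (k + j + 3))| ∧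
        B < |slTrace (wordMatrix V E (k + j + 3))| := by
      rcases lt_max_iff.1 a0 with h | h
      · constructor <;> rcases le_total A B with hab | hab <;> nlinarith
      · constructor <;> rcases le_total A B with hab | hab <;> nlinarith
    exact ⟨a2, by linarith, lt_max_of_lt_right h5.1⟩

/-! ### Growth of products by Cayley–Hamilton -/

/-- The sum of the absolute values of the entries. -/
noncomputable def entrySum (M : Matrix (Fin 2) (Fin 2) ℝ) : ℝ := ∑ i, ∑ j, |M i j|

lemma entrySum_nonneg (M : Matrix (Fin 2) (Fin 2) ℝ) : 0 ≤ entrySum M :=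
  Finset.sum_nonneg fun _ _ => Finset.sum_nonneg fun _ _ => abs_nonneg _

lemma entrySum_smul_sub_le (c : ℝ) (M N : Matrix (Fin 2) (Fin 2) ℝ) :
    entrySum (c • M - N) ≤ |c| * entrySum M + entrySum N := by
  unfold entrySum
  simp only [Finset.mul_sum, ← Finset.sum_add_distrib]
  refine Finset.sum_le_sum fun i _ => Finset.sum_le_sum fun j _ => ?_
  rw [← abs_mul]
  exact abs_sub _ _

/-- The adjugate permutes entries up to sign, so inverses of words cost no more than the words. -/
lemma entrySum_inv (A : Matrix.SpecialLinearGroup (Fin 2) ℝ) :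
    entrySum (A⁻¹ : Matrix.SpecialLinearGroup (Fin 2) ℝ) = entrySum A := by
  rw [Matrix.SpecialLinearGroup.coe_inv]
  simp [entrySum, Matrix.adjugate_fin_two, Fin.sum_univ_two]
  ring

lemma exists_opNorm_le : ∃ K : ℝ, 0 < K ∧ ∀ M, opNorm M ≤ K * entrySum M := by
  set f : Fin 2 → Fin 2 → ℝ := fun i j => opNorm (Matrix.single i j 1) with hf
  have hf0 : ∀ i j, 0 ≤ f i j := fun i j => norm_nonneg _
  refine ⟨1 + ∑ i, ∑ j, f i j, by
    have := Finset.sum_nonneg fun i (_ : i ∈ Finset.univ) =>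
      Finset.sum_nonneg fun j (_ : j ∈ Finset.univ) => hf0 i j
    linarith, fun M => ?_⟩
  have hle : ∀ i j, f i j ≤ 1 + ∑ i, ∑ j, f i j := fun i j => by
    have h1 := Finset.single_le_sum (f := f i) (fun j _ => hf0 i j) (Finset.mem_univ j)
    have h2 := Finset.single_le_sum (f := fun i => ∑ j, f i j)
      (fun i _ => Finset.sum_nonneg fun j _ => hf0 i j) (Finset.mem_univ i)
    linarith
  have hM : M = ∑ i, ∑ j, M i j • Matrix.single i j (1 : ℝ) := by
    conv_lhs => rw [Matrix.matrix_eq_sum_single M]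
    simp [Matrix.smul_single]
  have h1 : opNorm M ≤ ∑ i, ∑ j, |M i j| * f i j := by
    unfold opNorm
    conv_lhs => rw [hM]
    simp only [map_sum, map_smul]
    refine (norm_sum_le _ _).trans (Finset.sum_le_sum fun i _ => (norm_sum_le _ _).trans
      (Finset.sum_le_sum fun j _ => ?_))
    rw [norm_smul, Real.norm_eq_abs]
    rfl
  refine h1.trans ?_
  unfold entrySum
  simp only [Finset.mul_sum]
  refine Finset.sum_le_sum fun i _ => Finset.sum_le_sum fun j _ => ?_
  rw [mul_comm]
  exact mul_le_mul_of_nonneg_right (hle i j) (abs_nonneg _)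

lemma coe_eq_trace_sub_inv (A : Matrix.SpecialLinearGroup (Fin 2) ℝ) :
    (A : Matrix (Fin 2) (Fin 2) ℝ) =
      slTrace A • 1 - (A⁻¹ : Matrix.SpecialLinearGroup (Fin 2) ℝ) := by
  rw [← coe_add_coe_inv, add_sub_cancel_right]

/-- Cayley–Hamilton in the middle factor: the repetition `U` is either deleted or cancelled against
its neighbours. -/
lemma coe_mul_mul_eq (A U B : Matrix.SpecialLinearGroup (Fin 2) ℝ) :
    ((A * U * B : Matrix.SpecialLinearGroup (Fin 2) ℝ) : Matrix (Fin 2) (Fin 2) ℝ) =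
      slTrace U • ((A * B : Matrix.SpecialLinearGroup (Fin 2) ℝ) : Matrix (Fin 2) (Fin 2) ℝ) -
        (A * U⁻¹ * B : Matrix.SpecialLinearGroup (Fin 2) ℝ) := by
  rw [Matrix.SpecialLinearGroup.coe_mul, Matrix.SpecialLinearGroup.coe_mul, coe_eq_trace_sub_inv U,
    Matrix.SpecialLinearGroup.coe_mul, Matrix.SpecialLinearGroup.coe_mul,
    Matrix.SpecialLinearGroup.coe_mul, mul_sub, sub_mul]
  simp

lemma entrySum_mul_mul_le {S b : ℝ} {A U B C D : Matrix.SpecialLinearGroup (Fin 2) ℝ}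
    (hU : |slTrace U| ≤ S) (h1 : A * B = C) (h2 : A * U⁻¹ * B = D) (hC : entrySum C ≤ b)
    (hD : entrySum D ≤ b) :
    entrySum (A * U * B : Matrix.SpecialLinearGroup (Fin 2) ℝ) ≤ (S + 1) * b := by
  rw [coe_mul_mul_eq, h1, h2]
  refine (entrySum_smul_sub_le _ _ _).trans ?_
  have := mul_le_mul hU hC (entrySum_nonneg _) ((abs_nonneg _).trans hU)
  linarith

lemma stepProd_add_fib {V ω E : ℝ} {k : ℕ} {m : ℤ} {j : ℕ}
    (h : ∀ d, m < d → d ≤ m + j + 1 → ¬ Bad k ω d) :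
    stepProd V ω E (m + Nat.fib (k + 1)) j = stepProd V ω E m j := by
  refine stepProd_congr fun i h0 hi => ?_
  rw [add_right_comm]
  exact pot_add_fib (h _ (by lia) (by lia)) (h _ (by lia) (by lia))

/-- A word with period `u`, at most twice as long as `u`. -/
lemma entrySum_le_of_period {V ω E S b : ℝ} {k N : ℕ} {m : ℤ}
    (hbad : ∀ d, m < d → d ≤ m + N - Nat.fib (k + 1) + 1 → ¬ Bad k ω d)
    (hN : Nat.fib (k + 1) ≤ N) (hN' : N ≤ 2 * Nat.fib (k + 1))
    (hS : |slTrace (stepProd V ω E m (Nat.fib (k + 1)))| ≤ S)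
    (hb : ∀ (m : ℤ) (n : ℕ), n ≤ Nat.fib (k + 1) → entrySum (stepProd V ω E m n) ≤ b) :
    entrySum (stepProd V ω E m N) ≤ (S + 1) * b := by
  set p := Nat.fib (k + 1) with hp
  obtain ⟨z, rfl⟩ := Nat.exists_eq_add_of_le hN
  obtain ⟨y, hy⟩ := Nat.exists_eq_add_of_le (show z ≤ p by lia)
  have e1 : stepProd V ω E m (p + z) = stepProd V ω E m z * stepProd V ω E m p * 1 := by
    rw [stepProd_add, mul_one, stepProd_add_fib fun d h1 h2 => hbad d h1 (by push_cast; lia)]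
  have e2 : stepProd V ω E m p = stepProd V ω E (m + z) y * stepProd V ω E m z := by
    rw [hy, stepProd_add]
  rw [e1]
  -- The period block is `Y * Z` with `Z` the repeated prefix, so `Z * (Y * Z)⁻¹ = Y⁻¹`.
  refine entrySum_mul_mul_le (C := stepProd V ω E m z) (D := (stepProd V ω E (m + z) y)⁻¹) hS
    (mul_one _) ?_ (hb _ _ (by lia)) ?_
  · rw [e2]
    group
  · rw [entrySum_inv]
    exact hb _ _ (by lia)

lemma stepProd_two_mul_fib {V ω E : ℝ} {k : ℕ} {m : ℤ}
    (h : ∀ d, m < d → d ≤ m + Nat.fib (k + 1) + 1 → ¬ Bad k ω d) :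
    stepProd V ω E m (Nat.fib (k + 1) + Nat.fib (k + 1)) =
      stepProd V ω E m (Nat.fib (k + 1)) * stepProd V ω E m (Nat.fib (k + 1)) := by
  rw [stepProd_add, stepProd_add_fib h]

/-- A word that begins with a square. -/
lemma entrySum_le_of_prefix_square {V ω E S b : ℝ} {k N B : ℕ} {m : ℤ}
    (hbad : ∀ d, m < d → d ≤ m + Nat.fib (k + 1) + 1 → ¬ Bad k ω d)
    (hN : 2 * Nat.fib (k + 1) ≤ N) (hN' : N ≤ B + Nat.fib (k + 1))
    (hS : |slTrace (stepProd V ω E m (Nat.fib (k + 1)))| ≤ S)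
    (hb : ∀ (m : ℤ) (n : ℕ), n ≤ B → entrySum (stepProd V ω E m n) ≤ b) :
    entrySum (stepProd V ω E m N) ≤ (S + 1) * b := by
  have h2 := stepProd_two_mul_fib (V := V) (E := E) hbad
  have h3 := stepProd_add_fib (V := V) (E := E) hbad
  set p := Nat.fib (k + 1) with hp
  obtain ⟨z, rfl⟩ := Nat.exists_eq_add_of_le hN
  have e1 : stepProd V ω E m (2 * p + z) =
      stepProd V ω E (m + p + p) z * stepProd V ω E m p * stepProd V ω E m p := by
    rw [two_mul, stepProd_add, h2, mul_assoc]
    push_cast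
    rw [add_assoc m]
  have e2 : stepProd V ω E (m + p) (p + z) =
      stepProd V ω E (m + p + p) z * stepProd V ω E m p := by
    rw [stepProd_add, h3]
  rw [e1]
  exact entrySum_mul_mul_le (D := stepProd V ω E (m + p + p) z) hS e2.symm (by group)
    (hb _ _ (by lia)) (hb _ _ (by lia))

/-- A word that ends with a square. -/
lemma entrySum_le_of_suffix_square {V ω E S b : ℝ} {k z B : ℕ} {m : ℤ}
    (hbad : ∀ d, m + z < d → d ≤ m + z + Nat.fib (k + 1) + 1 → ¬ Bad k ω d)
    (hB : z + Nat.fib (k + 1) ≤ B)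
    (hS : |slTrace (stepProd V ω E (m + z) (Nat.fib (k + 1)))| ≤ S)
    (hb : ∀ (m : ℤ) (n : ℕ), n ≤ B → entrySum (stepProd V ω E m n) ≤ b) :
    entrySum (stepProd V ω E m (z + (Nat.fib (k + 1) + Nat.fib (k + 1)))) ≤ (S + 1) * b := by
  rw [stepProd_add, stepProd_two_mul_fib hbad]
  refine entrySum_mul_mul_le hS (stepProd_add V ω E m z _).symm (?_ : _ = stepProd V ω E m z)
    (hb _ _ hB) (hb _ _ (by lia))
  group

/-- Either the period `fib (k + 2)` survives on the factor, or a level-`(k + 1)` bad site breaks it.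
In the second case level `k` has no bad site nearby, and the factor has period `fib (k + 1)` or
contains a square of such a block at one end. -/
lemma entrySum_stepProd_succ_level {V ω E S b : ℝ} {k : ℕ} (hk : 1 ≤ k) (hS0 : 0 ≤ S)
    (hS : ∀ m, ¬ Bad k ω (m + 1) → |slTrace (stepProd V ω E m (Nat.fib (k + 1)))| ≤ S)
    (hS' : ∀ m, ¬ Bad (k + 1) ω (m + 1) → |slTrace (stepProd V ω E m (Nat.fib (k + 2)))| ≤ S)
    (hb : ∀ (m : ℤ) (n : ℕ), n ≤ Nat.fib (k + 2) → entrySum (stepProd V ω E m n) ≤ b)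
    (m : ℤ) (N : ℕ) (hN : N ≤ Nat.fib (k + 3)) :
    entrySum (stepProd V ω E m N) ≤ (S + 1) * b := by
  have hb0 : 0 ≤ b := (entrySum_nonneg _).trans (hb m 0 (by lia))
  rw [Nat.fib_add_two (n := k + 1)] at hN
  have hp : Nat.fib (k + 2) = Nat.fib k + Nat.fib (k + 1) := Nat.fib_add_two
  have hk0 : 0 < Nat.fib k := Nat.fib_pos.2 hk
  have hle : Nat.fib k ≤ Nat.fib (k + 1) := Nat.fib_mono (by lia)
  rw [show k + 1 + 1 = k + 2 from rfl] at hN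
  rcases le_or_gt N (Nat.fib (k + 2)) with h1 | h1
  · nlinarith [hb m N h1]
  by_cases h2 : ∀ d, m < d → d ≤ m + N - Nat.fib (k + 2) + 1 → ¬ Bad (k + 1) ω d
  · exact entrySum_le_of_period (k := k + 1) h2 h1.le
      (by rw [show k + 1 + 1 = k + 2 from rfl]; lia)
      (hS' m (h2 _ (by lia) (by lia))) hb
  push Not at h2
  obtain ⟨e, he1, he2, he⟩ := h2
  have hsep : ∀ d, d - e ≤ Nat.fib (k + 1) → e - d < Nat.fib (k + 1) → ¬ Bad k ω d :=
    fun d h3 h4 hd => hd.separated hk he h3 h4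
  rcases lt_or_ge N (2 * Nat.fib (k + 1)) with h3 | h3
  · have h4 : ∀ d, m < d → d ≤ m + N - Nat.fib (k + 1) + 1 → ¬ Bad k ω d :=
      fun d h5 h6 => hsep d (by lia) (by lia)
    exact entrySum_le_of_period h4 (by lia) h3.le (hS m (h4 _ (by lia) (by lia)))
      fun m n hn => hb m n (by lia)
  rcases le_or_gt e (m + Nat.fib (k + 1)) with h4 | h4
  · have h5 : ∀ d, m < d → d ≤ m + Nat.fib (k + 1) + 1 → ¬ Bad k ω d :=
      fun d h5 h6 => hsep d (by lia) (by lia)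
    exact entrySum_le_of_prefix_square h5 h3 (by lia) (hS m (h5 _ (by lia) (by lia))) hb
  -- Only `e = m + fib (k + 1) + 1` remains, which forces `N` to be maximal; the square then starts
  -- at offset `fib k`.
  · have h5 : ∀ d, m + Nat.fib k < d → d ≤ m + Nat.fib k + Nat.fib (k + 1) + 1 → ¬ Bad k ω d :=
      fun d h5 h6 => hsep d (by lia) (by lia)
    have hN2 : N = Nat.fib k + (Nat.fib (k + 1) + Nat.fib (k + 1)) := by lia
    rw [hN2]
    exact entrySum_le_of_suffix_square h5 (by lia) (hS _ (h5 _ (by lia) (by lia))) hb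

lemma entrySum_stepMatrix_mul_le {V ω E K : ℝ} (hV : 0 ≤ V) (hE : |E| + V + 1 ≤ K) (n : ℤ)
    (M : Matrix (Fin 2) (Fin 2) ℝ) :
    entrySum ((stepMatrix V ω E n : Matrix (Fin 2) (Fin 2) ℝ) * M) ≤ (K + 1) * entrySum M := by
  have h1 : |E - V * pot ω n| ≤ K - 1 := by
    have := abs_sub E (V * pot ω n)
    rw [abs_mul, abs_of_nonneg hV] at this
    nlinarith [abs_pot_le ω n]
  have h2 : ∀ a b : ℝ, |(E - V * pot ω n) * a - b| ≤ K * |a| + |b| := fun a b => by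
    refine (abs_sub _ _).trans ?_
    rw [abs_mul]
    nlinarith [abs_nonneg a]
  have e1 := h2 (M 0 0) (M 1 0)
  have e2 := h2 (M 0 1) (M 1 1)
  have hK : 0 ≤ K := by linarith [abs_nonneg (E - V * pot ω n)]
  simp only [entrySum, stepMatrix, Fin.sum_univ_two, Matrix.mul_apply, Matrix.of_apply,
    Matrix.cons_val_zero, Matrix.cons_val_one, neg_one_mul, one_mul, zero_mul, add_zero,
    Matrix.cons_val', Matrix.cons_val_fin_one, ← sub_eq_add_neg]
  nlinarith [mul_nonneg hK (abs_nonneg (M 1 0)), mul_nonneg hK (abs_nonneg (M 1 1))]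

lemma entrySum_stepProd_le {V ω E K : ℝ} (hV : 0 ≤ V) (hE : |E| + V + 1 ≤ K) (m : ℤ) (n : ℕ) :
    entrySum (stepProd V ω E m n) ≤ 2 * (K + 1) ^ n := by
  have hK : 0 ≤ K := by linarith [abs_nonneg E]
  induction n with
  | zero => simp [stepProd, entrySum, Fin.sum_univ_two]; norm_num
  | succ n ih =>
    rw [stepProd, Matrix.SpecialLinearGroup.coe_mul, pow_succ]
    refine (entrySum_stepMatrix_mul_le hV hE _ _).trans ?_
    nlinarith

lemma entrySum_stepProd_le_pow {V E : ℝ} (hV : 0 ≤ V)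
    (hE : ∀ k, 1 ≤ k → |slTrace (wordMatrix V E k)| ≤ 2 + V) (ω : ℝ) (k : ℕ) :
    ∀ (m : ℤ) (N : ℕ), N ≤ Nat.fib (k + 5) →
      entrySum (stepProd V ω E m N) ≤ 2 * (4 * V + 4) ^ 5 * (3 + V) ^ k := by
  have hS : ∀ k, 3 ≤ k → ∀ m, ¬ Bad k ω (m + 1) →
      |slTrace (stepProd V ω E m (Nat.fib (k + 1)))| ≤ 2 + V := fun k hk m hm => by
    rw [slTrace_stepProd hk hm]
    exact hE k (by lia)
  induction k with
  | zero =>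
    intro m N hN
    have h1 := hE 1 le_rfl
    rw [slTrace_wordMatrix_one] at h1
    have h2 : |E| + V + 1 ≤ 4 * V + 3 := by
      have := abs_add_le (E - V) V
      rw [sub_add_cancel, abs_of_nonneg hV] at this
      linarith
    refine (entrySum_stepProd_le hV h2 m N).trans ?_
    rw [pow_zero, mul_one, show 4 * V + 4 = 4 * V + 3 + 1 by ring]
    have h3 : Nat.fib (0 + 5) = 5 := rfl
    gcongr
    · linarith
    · lia
  | succ k ih =>
    intro m N hN
    -- The shift by three meets the level restriction of `slTrace_stepProd`; this is why the
    -- induction starts at `fib 5`.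
    refine (entrySum_stepProd_succ_level (k := k + 3) (by lia) (by linarith)
      (hS _ (by lia)) (hS _ (by lia)) ih m N hN).trans (le_of_eq ?_)
    ring

/-! ### Periodic approximants and invertibility of `H - E` -/

/-- The Schrödinger operator on the cycle `ℤ / p`. -/
noncomputable def cyclicHamiltonian {p : ℕ} (w : ZMod p → ℝ) :
    EuclideanSpace ℝ (ZMod p) →ₗ[ℝ] EuclideanSpace ℝ (ZMod p) where
  toFun u := WithLp.toLp 2 fun j => u (j + 1) + u (j - 1) + w j * u j
  map_add' u v := by
    ext j
    simp
    ring
  map_smul' c u := by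
    ext j
    simp
    ring

lemma cyclicHamiltonian_apply {p : ℕ} (w : ZMod p → ℝ) (u : EuclideanSpace ℝ (ZMod p))
    (j : ZMod p) : cyclicHamiltonian w u j = u (j + 1) + u (j - 1) + w j * u j := rfl

lemma isSymmetric_cyclicHamiltonian {p : ℕ} [NeZero p] (w : ZMod p → ℝ) :
    (cyclicHamiltonian w).IsSymmetric := by
  intro u v
  simp only [PiLp.inner_apply, cyclicHamiltonian_apply, RCLike.inner_apply, conj_trivial]
  have h1 : ∑ j, v j * u (j + 1) = ∑ j, v (j - 1) * u j := by
    rw [← Equiv.sum_comp (Equiv.addRight (1 : ZMod p)) fun j => v (j - 1) * u j]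
    simp
  have h2 : ∑ j, v j * u (j - 1) = ∑ j, v (j + 1) * u j := by
    rw [← Equiv.sum_comp (Equiv.addRight (1 : ZMod p)) fun j => v j * u (j - 1)]
    simp
  simp only [mul_add, add_mul, Finset.sum_add_distrib]
  rw [h1, h2, add_comm (∑ j, v (j + 1) * u j)]
  congr 1
  exact Finset.sum_congr rfl fun j _ => by ring

/-- A symmetric operator without eigenvalues near `c` is bounded below after a shift by `c`. -/
lemma norm_sub_smul_ge_of_isSymmetric {F : Type*} [NormedAddCommGroup F] [InnerProductSpace ℝ F]
    [FiniteDimensional ℝ F] {T : F →ₗ[ℝ] F} (hT : T.IsSymmetric) {c ε : ℝ} (hε : 0 ≤ ε)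
    (h : ∀ (μ : ℝ) (v : F), v ≠ 0 → T v = μ • v → ε ≤ |μ - c|) (u : F) :
    ε ^ 2 * ‖u‖ ^ 2 ≤ ‖T u - c • u‖ ^ 2 := by
  set B := hT.eigenvectorBasis rfl with hB
  rw [← B.repr.norm_map u, ← B.repr.norm_map (T u - c • u), EuclideanSpace.norm_sq_eq,
    EuclideanSpace.norm_sq_eq, Finset.mul_sum]
  refine Finset.sum_le_sum fun i _ => ?_
  have h1 := hT.eigenvectorBasis_apply_self_apply rfl u i
  have h2 := h (hT.eigenvalues rfl i) (B i) (B.orthonormal.ne_zero i)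
    (hT.apply_eigenvectorBasis rfl i)
  rw [← hB] at h1
  simp only [map_sub, map_smul, PiLp.sub_apply, PiLp.smul_apply, smul_eq_mul, Real.norm_eq_abs]
  rw [h1, RCLike.ofReal_real_eq_id, id, ← sub_mul, abs_mul, mul_pow]
  exact mul_le_mul_of_nonneg_right (pow_le_pow_left₀ hε h2 2) (by positivity)

lemma slTrace_eq_two_of_fixed {A : Matrix.SpecialLinearGroup (Fin 2) ℝ} {x : Fin 2 → ℝ}
    (hx : x ≠ 0) (h : (A : Matrix (Fin 2) (Fin 2) ℝ) *ᵥ x = x) : slTrace A = 2 := by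
  have h1 : ((A : Matrix (Fin 2) (Fin 2) ℝ) - 1).det = 0 := by
    rw [← Matrix.exists_mulVec_eq_zero_iff]
    exact ⟨x, hx, by rw [Matrix.sub_mulVec, h, Matrix.one_mulVec, sub_self]⟩
  have h2 := A.det_coe
  rw [Matrix.det_fin_two] at h1 h2
  simp at h1
  rw [slTrace, Matrix.trace_fin_two]
  linarith

/-- Going once around the cycle, the eigenvector gives a nonzero vector fixed by the monodromy. -/
lemma slTrace_eq_two_of_eigenvector {V ω μ : ℝ} {b : ℤ} {p : ℕ} [NeZero p] {u : ZMod p → ℝ}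
    (hu : u ≠ 0)
    (h : ∀ j, u (j + 1) + u (j - 1) + V * pot ω (b + j.val) * u j = μ * u j) :
    slTrace (stepProd V ω μ (b - 1) p) = 2 := by
  have key : ∀ n : ℕ, n ≤ p → (stepProd V ω μ (b - 1) n : Matrix (Fin 2) (Fin 2) ℝ) *ᵥ
      ![u 0, u (-1)] = ![u n, u ((n : ZMod p) - 1)] := by
    intro n
    induction n with
    | zero => simp [stepProd]
    | succ n ih =>
      intro hn
      have h1 := h n
      rw [ZMod.val_natCast_of_lt (by lia)] at h1
      rw [stepProd, Matrix.SpecialLinearGroup.coe_mul, ← Matrix.mulVec_mulVec, ih (by lia),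
        show b - 1 + (n : ℤ) + 1 = b + n by ring]
      ext i
      fin_cases i
      · simp [stepMatrix, Matrix.mulVec, dotProduct]
        linarith
      · simp [stepMatrix, Matrix.mulVec, dotProduct]
  have hp := key p le_rfl
  rw [ZMod.natCast_self, zero_sub] at hp
  refine slTrace_eq_two_of_fixed (fun h0 => hu ?_) hp
  funext j
  have h1 := key j.val (ZMod.val_lt j).le
  rw [h0, Matrix.mulVec_zero] at h1
  have := congrFun h1 0
  simpa using this.symm

lemma cyclic_bound {V ω E ε : ℝ} (hε : 0 ≤ ε) {k : ℕ} (hk : 3 ≤ k)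
    (h : ∀ E', |E' - E| < ε → slTrace (wordMatrix V E' k) ≠ 2) {b : ℤ} (hb : ¬ Bad k ω b)
    (u : ZMod (Nat.fib (k + 1)) → ℝ) [NeZero (Nat.fib (k + 1))] :
    ε ^ 2 * ∑ j, u j ^ 2 ≤
      ∑ j, (u (j + 1) + u (j - 1) + V * pot ω (b + j.val) * u j - E * u j) ^ 2 := by
  have h1 := norm_sub_smul_ge_of_isSymmetric
    (isSymmetric_cyclicHamiltonian fun j : ZMod (Nat.fib (k + 1)) => V * pot ω (b + j.val))
    (c := E) hε (fun μ v hv hT => by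
      by_contra! hlt
      refine h μ hlt ?_
      rw [← slTrace_stepProd hk (ω := ω) (m := b - 1) (by rwa [sub_add_cancel])]
      refine slTrace_eq_two_of_eigenvector (u := fun j => v j) (fun h0 => hv ?_) fun j => ?_
      · ext j
        exact congrFun h0 j
      · have := congrArg (fun x : EuclideanSpace ℝ (ZMod (Nat.fib (k + 1))) => x j) hT
        simpa [cyclicHamiltonian_apply] using this) (WithLp.toLp 2 u)
  rw [EuclideanSpace.norm_sq_eq, EuclideanSpace.norm_sq_eq] at h1
  simpa [cyclicHamiltonian_apply] using h1

lemma sum_zmod_val {p : ℕ} [NeZero p] (G : ℕ → ℝ) :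
    ∑ j : ZMod p, G j.val = ∑ i ∈ Finset.range p, G i := by
  obtain ⟨n, rfl⟩ := Nat.exists_eq_succ_of_ne_zero (NeZero.ne p)
  exact Fin.sum_univ_eq_sum_range G (n + 1)

/-- `u`, translated and cut off outside `[1, L]`. -/
noncomputable def cutoff (u : ℤ → ℝ) (b : ℤ) (L i : ℕ) : ℝ :=
  if 1 ≤ i ∧ i ≤ L then u (b + i) else 0

lemma cutoff_of_mem {u : ℤ → ℝ} {b : ℤ} {L i : ℕ} (h : 1 ≤ i) (h' : i ≤ L) :
    cutoff u b L i = u (b + i) := if_pos ⟨h, h'⟩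

lemma cutoff_zero {u : ℤ → ℝ} {b : ℤ} {L : ℕ} : cutoff u b L 0 = 0 := if_neg (by lia)

lemma cutoff_of_gt {u : ℤ → ℝ} {b : ℤ} {L i : ℕ} (h : L < i) : cutoff u b L i = 0 :=
  if_neg (by lia)

lemma cutoff_val_add_one {p L : ℕ} [NeZero p] (hp : L + 2 ≤ p) (u : ℤ → ℝ) (b : ℤ) (j : ZMod p) :
    cutoff u b L (j + 1).val = cutoff u b L (j.val + 1) := by
  have : Fact (1 < p) := ⟨by lia⟩
  have hj := ZMod.val_lt j
  rw [ZMod.val_add, ZMod.val_one]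
  rcases (show j.val + 1 < p ∨ j.val + 1 = p by lia) with h | h
  · rw [Nat.mod_eq_of_lt h]
  · rw [h, Nat.mod_self, cutoff_zero, cutoff_of_gt (by lia)]

lemma cutoff_val_sub_one {p L : ℕ} [NeZero p] (hp : L + 2 ≤ p) (u : ℤ → ℝ) (b : ℤ) (j : ZMod p) :
    cutoff u b L (j - 1).val = cutoff u b L (j.val - 1) := by
  have : Fact (1 < p) := ⟨by lia⟩
  rcases Nat.eq_zero_or_pos j.val with h | h
  · rw [h, cutoff_zero, cutoff_of_gt]
    rw [(ZMod.val_eq_zero j).1 h, zero_sub, ZMod.val_neg_of_ne_zero, ZMod.val_one]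
    lia
  · rw [ZMod.val_sub (by rwa [ZMod.val_one]), ZMod.val_one]

/-- The lower bound for the Fibonacci operator on a window, with boundary terms. -/
lemma window_bound {V ω E ε : ℝ} (hε : 0 ≤ ε) {K L : ℕ} (hK : 3 ≤ K) (hL : 2 ≤ L)
    (hLK : L + 2 ≤ Nat.fib (K + 1))
    (h : ∀ k, K ≤ k → ∀ E', |E' - E| < ε → slTrace (wordMatrix V E' k) ≠ 2)
    (u : ℤ → ℝ) (b : ℤ) :
    ε ^ 2 * ∑ i ∈ Finset.Icc 1 L, u (b + i) ^ 2 ≤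
      2 * ∑ i ∈ Finset.Icc 1 L,
        (u (b + i + 1) + u (b + i - 1) + V * pot ω (b + i) * u (b + i) - E * u (b + i)) ^ 2 +
      (u (b + 1) ^ 2 + 2 * u b ^ 2 + 2 * u (b + (L + 1 : ℕ)) ^ 2 + u (b + L) ^ 2) := by
  -- A site cannot be bad at two consecutive levels, so one of `K`, `K + 1` gives a cycle whose
  -- monodromy has the standard trace.
  obtain ⟨k, hKk, hb⟩ : ∃ k, K ≤ k ∧ ¬ Bad k ω b := by
    by_cases hb : Bad K ω b
    · refine ⟨K + 1, by lia, fun hb' => hb.separated (by lia) hb' ?_ ?_⟩ <;> lia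
    · exact ⟨K, le_rfl, hb⟩
  have hLk : L + 2 ≤ Nat.fib (k + 1) := hLK.trans (Nat.fib_mono (by lia))
  have : NeZero (Nat.fib (k + 1)) := ⟨by lia⟩
  have h1 := cyclic_bound hε (by lia) (h k hKk) hb (fun j => cutoff u b L j.val)
  simp only [cutoff_val_add_one hLk, cutoff_val_sub_one hLk] at h1
  rw [sum_zmod_val fun i => cutoff u b L i ^ 2,
    sum_zmod_val fun i => (cutoff u b L (i + 1) + cutoff u b L (i - 1) +
      V * pot ω (b + i) * cutoff u b L i - E * cutoff u b L i) ^ 2] at h1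
  set p := Nat.fib (k + 1)
  have hsub : Finset.Icc 1 L ⊆ Finset.range p := fun i hi => by
    rw [Finset.mem_Icc] at hi
    exact Finset.mem_range.2 (by lia)
  have e1 : ∑ i ∈ Finset.Icc 1 L, u (b + i) ^ 2 = ∑ i ∈ Finset.range p, cutoff u b L i ^ 2 := by
    rw [← Finset.sum_subset hsub fun i _ hi => ?_]
    · refine Finset.sum_congr rfl fun i hi => ?_
      rw [Finset.mem_Icc] at hi
      rw [cutoff_of_mem hi.1 hi.2]
    · rw [Finset.mem_Icc] at hi
      rw [cutoff, if_neg hi]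
      norm_num
  rw [e1]
  refine h1.trans ?_
  set f : ℕ → ℝ := fun i =>
    (u (b + i + 1) + u (b + i - 1) + V * pot ω (b + i) * u (b + i) - E * u (b + i)) ^ 2 with hf
  have hf0 : ∀ i, 0 ≤ f i := fun i => sq_nonneg _
  have e2 : ∑ i ∈ Finset.Icc 1 L, f i =
      ∑ i ∈ Finset.range p, if i ∈ Finset.Icc 1 L then f i else 0 := by
    rw [Finset.sum_ite_mem, Finset.inter_eq_right.2 hsub]
  have e3 : ∀ (j : ℕ) (c : ℝ), j < p → ∑ i ∈ Finset.range p, (if i = j then c else 0) = c := by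
    intro j c hj
    rw [Finset.sum_ite_eq' (Finset.range p) j, if_pos (Finset.mem_range.2 hj)]
  -- The cutoff creates errors only at sites `0`, `1`, `L`, `L + 1`; written as one-point sums, they
  -- allow a site-by-site comparison.
  rw [e2, ← e3 0 (u (b + 1) ^ 2) (by lia), ← e3 1 (2 * u b ^ 2) (by lia),
    ← e3 L (2 * u (b + (L + 1 : ℕ)) ^ 2) (by lia), ← e3 (L + 1) (u (b + L) ^ 2) (by lia),
    Finset.mul_sum, ← Finset.sum_add_distrib, ← Finset.sum_add_distrib, ← Finset.sum_add_distrib,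
    ← Finset.sum_add_distrib]
  refine Finset.sum_le_sum fun i _ => ?_
  have hsq : ∀ x y : ℝ, (x - y) ^ 2 ≤ 2 * x ^ 2 + 2 * y ^ 2 := fun x y => by
    nlinarith [sq_nonneg (x + y)]
  rcases (show i = 0 ∨ (i = 1 ∧ i < L) ∨ (1 < i ∧ i < L) ∨ i = L ∨ i = L + 1 ∨ L + 1 < i by lia)
    with hi | ⟨hi, hi'⟩ | ⟨hi, hi'⟩ | hi | hi | hi
  · subst hi
    rw [if_neg (by simp), if_pos rfl, if_neg (by lia), if_neg (by lia), if_neg (by lia),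
      cutoff_zero, Nat.zero_add, cutoff_of_mem le_rfl (by lia)]
    simp
  · subst hi
    rw [if_pos (by rw [Finset.mem_Icc]; lia), if_neg (by lia), if_pos rfl, if_neg (by lia),
      if_neg (by lia), tsub_self, cutoff_zero, cutoff_of_mem le_rfl (by lia),
      cutoff_of_mem (by lia) (by lia)]
    have := hsq (u (b + (1 : ℕ) + 1) + u (b + (1 : ℕ) - 1) + V * pot ω (b + (1 : ℕ)) *
      u (b + (1 : ℕ)) - E * u (b + (1 : ℕ))) (u b)
    simp only [hf]
    refine le_trans (le_of_eq ?_) (this.trans (le_of_eq ?_))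
    · push_cast
      rw [add_sub_cancel_right, add_assoc b 1 1, one_add_one_eq_two]
      ring
    · ring
  · rw [if_pos (by rw [Finset.mem_Icc]; lia), if_neg (by lia), if_neg (by lia), if_neg (by lia),
      if_neg (by lia), cutoff_of_mem (by lia) (by lia), cutoff_of_mem (by lia) (by lia),
      cutoff_of_mem (by lia) (by lia)]
    have e4 : b + ((i - 1 : ℕ) : ℤ) = b + i - 1 := by lia
    have e5 : b + ((i + 1 : ℕ) : ℤ) = b + i + 1 := by lia
    have := hf0 i
    rw [e4, e5]
    simp only [hf] at this ⊢
    linarith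
  · subst hi
    rw [if_pos (by rw [Finset.mem_Icc]; lia), if_neg (by lia), if_neg (by lia), if_pos rfl,
      if_neg (by lia), cutoff_of_gt (by lia), cutoff_of_mem (by lia) (by lia),
      cutoff_of_mem (by lia) (by lia)]
    have e4 : b + ((i - 1 : ℕ) : ℤ) = b + i - 1 := by lia
    have e5 : b + ((i + 1 : ℕ) : ℤ) = b + i + 1 := by lia
    have := hsq (u (b + i + 1) + u (b + i - 1) + V * pot ω (b + i) * u (b + i) -
      E * u (b + i)) (u (b + i + 1))
    rw [e4, e5]
    simp only [hf]
    refine le_trans (le_of_eq ?_) (this.trans (le_of_eq ?_)) <;> ring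
  · subst hi
    rw [if_neg (by rw [Finset.mem_Icc]; lia), if_neg (by lia), if_neg (by lia), if_neg (by lia),
      if_pos rfl, cutoff_of_gt (by lia), add_tsub_cancel_right, cutoff_of_mem (by lia) le_rfl,
      cutoff_of_gt (by lia)]
    simp
  · rw [if_neg (by rw [Finset.mem_Icc]; lia), if_neg (by lia), if_neg (by lia), if_neg (by lia),
      if_neg (by lia), cutoff_of_gt (by lia), cutoff_of_gt (by lia), cutoff_of_gt (by lia)]
    simp

/-- By symmetry the orthogonal complement of the range lies in the kernel, which the lower bound
makes trivial. -/
lemma isUnit_of_isSymmetric_of_norm_le {F : Type*} [NormedAddCommGroup F] [InnerProductSpace ℂ F]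
    [CompleteSpace F] {f : F →L[ℂ] F} (hf : ∀ x y, inner ℂ (f x) y = inner ℂ x (f y)) {c : NNReal}
    (h : ∀ x, ‖x‖ ≤ c * ‖f x‖) : IsUnit f := by
  rw [ContinuousLinearMap.isUnit_iff_bijective,
    ContinuousLinearMap.bijective_iff_dense_range_and_antilipschitz]
  refine ⟨?_, c, f.antilipschitz_of_bound h⟩
  rw [Submodule.topologicalClosure_eq_top_iff, Submodule.eq_bot_iff]
  intro x hx
  have h1 : f x = 0 := by
    refine ext_inner_left ℂ fun y => ?_
    rw [← hf, hx (f y) ⟨y, rfl⟩, inner_zero_right]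
  have h2 := h x
  rw [h1, norm_zero, mul_zero] at h2
  exact norm_le_zero_iff.1 h2

lemma inner_shift (k : ℤ) (ψ φ : EllTwo) : inner ℂ (shift k ψ) φ = inner ℂ ψ (shift (-k) φ) := by
  rw [lp.inner_eq_tsum, lp.inner_eq_tsum,
    ← (Equiv.addRight k).tsum_eq fun n => inner ℂ (ψ n) (shift (-k) φ n)]
  refine tsum_congr fun n => ?_
  change inner ℂ (ψ (n + k)) (φ n) = inner ℂ (ψ (n + k)) (φ (n + k + -k))
  rw [add_neg_cancel_right]

lemma inner_potOp (ω : ℝ) (ψ φ : EllTwo) : inner ℂ (potOp ω ψ) φ = inner ℂ ψ (potOp ω φ) := by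
  rw [lp.inner_eq_tsum, lp.inner_eq_tsum]
  refine tsum_congr fun n => ?_
  change inner ℂ ((pot ω n : ℂ) * ψ n) (φ n) = inner ℂ (ψ n) ((pot ω n : ℂ) * φ n)
  simp only [RCLike.inner_apply, map_mul, Complex.conj_ofReal]
  ring

lemma inner_hamiltonian (V ω : ℝ) (ψ φ : EllTwo) :
    inner ℂ (hamiltonian V ω ψ) φ = inner ℂ ψ (hamiltonian V ω φ) := by
  simp only [hamiltonian, _root_.add_apply, _root_.smul_apply,
    inner_add_left, inner_add_right, inner_smul_left, inner_smul_right, Complex.conj_ofReal]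
  rw [inner_shift, inner_shift, inner_potOp, neg_neg]
  ring

lemma hasSum_norm_sq (ψ : EllTwo) : HasSum (fun n => ‖ψ n‖ ^ 2) (‖ψ‖ ^ 2) := by
  have := lp.hasSum_norm (p := 2) (by norm_num) ψ
  simpa using this

lemma hasSum_norm_sq_add (ψ : EllTwo) (c : ℤ) :
    HasSum (fun n => ‖ψ (n + c)‖ ^ 2) (‖ψ‖ ^ 2) :=
  (Equiv.addRight c).hasSum_iff.2 (hasSum_norm_sq ψ)

/-- If no periodic approximant has an eigenvalue near `E`, then `H - E` is bounded below. -/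
lemma norm_sq_le_of_slTrace_ne_two {V ω E ε : ℝ} (hε : 0 ≤ ε) {K L : ℕ} (hK : 3 ≤ K) (hL : 2 ≤ L)
    (hLK : L + 2 ≤ Nat.fib (K + 1))
    (h : ∀ k, K ≤ k → ∀ E', |E' - E| < ε → slTrace (wordMatrix V E' k) ≠ 2) (ψ : EllTwo) :
    ε ^ 2 * (L * ‖ψ‖ ^ 2) ≤
      2 * (L * ‖(hamiltonian V ω - (E : ℂ) • ContinuousLinearMap.id ℂ EllTwo) ψ‖ ^ 2) +
        (‖ψ‖ ^ 2 + 2 * ‖ψ‖ ^ 2 + 2 * ‖ψ‖ ^ 2 + ‖ψ‖ ^ 2) := by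
  set Φ := (hamiltonian V ω - (E : ℂ) • ContinuousLinearMap.id ℂ EllTwo) ψ with hΦ
  have hΦn : ∀ n, Φ n = ψ (n + 1) + ψ (n - 1) + V * pot ω n * ψ n - E * ψ n := fun n => by
    rw [← hamiltonian_apply]
    rfl
  have hsq : ∀ z : ℂ, ‖z‖ ^ 2 = z.re ^ 2 + z.im ^ 2 := fun z => by
    rw [← Complex.normSq_eq_norm_sq, Complex.normSq_apply]
    ring
  have hloc : ∀ b : ℤ, ε ^ 2 * ∑ i ∈ Finset.Icc 1 L, ‖ψ (b + (i : ℤ))‖ ^ 2 ≤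
      2 * ∑ i ∈ Finset.Icc 1 L, ‖Φ (b + (i : ℤ))‖ ^ 2 + (‖ψ (b + 1)‖ ^ 2 + 2 * ‖ψ (b + 0)‖ ^ 2 +
        2 * ‖ψ (b + (L + 1 : ℕ))‖ ^ 2 + ‖ψ (b + (L : ℤ))‖ ^ 2) := by
    intro b
    have h1 := window_bound (ω := ω) hε hK hL hLK h (fun n => (ψ n).re) b
    have h2 := window_bound (ω := ω) hε hK hL hLK h (fun n => (ψ n).im) b
    have e1 : ∀ n, (Φ n).re = (ψ (n + 1)).re + (ψ (n - 1)).re + V * pot ω n * (ψ n).re -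
        E * (ψ n).re := fun n => by simp [hΦn]
    have e2 : ∀ n, (Φ n).im = (ψ (n + 1)).im + (ψ (n - 1)).im + V * pot ω n * (ψ n).im -
        E * (ψ n).im := fun n => by simp [hΦn]
    simp only [← e1] at h1
    simp only [← e2] at h2
    simp only [hsq, Finset.sum_add_distrib, add_zero]
    linarith
  -- Summing over all windows counts each interior term `L` times but each boundary term once, so
  -- large `L` makes the boundary negligible.
  have hl := (hasSum_sum fun i (_ : i ∈ Finset.Icc 1 L) => hasSum_norm_sq_add ψ i).mul_left (ε ^ 2)
  have hr := ((hasSum_sum fun i (_ : i ∈ Finset.Icc 1 L) =>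
    hasSum_norm_sq_add Φ i).mul_left 2).add
      ((((hasSum_norm_sq_add ψ 1).add ((hasSum_norm_sq_add ψ 0).mul_left 2)).add
        ((hasSum_norm_sq_add ψ (L + 1 : ℕ)).mul_left 2)).add (hasSum_norm_sq_add ψ L))
  have := hasSum_le hloc hl hr
  simpa using this

lemma not_mem_spec {V ω E ε : ℝ} (hε : 0 < ε) {K : ℕ}
    (h : ∀ k, K ≤ k → ∀ E', |E' - E| < ε → slTrace (wordMatrix V E' k) ≠ 2) :
    E ∉ spec V ω := by
  obtain ⟨L₀, hL₀⟩ := exists_nat_gt (8 / ε ^ 2)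
  set L := L₀ + 2 with hL
  -- The boundary terms total `6 * ‖ψ‖ ^ 2`; the surplus 2 cancels the factor 2 in front of the main
  -- term.
  have hLε : 8 ≤ ε ^ 2 * L := by
    rw [div_lt_iff₀ (by positivity)] at hL₀
    push_cast [hL]
    nlinarith [sq_nonneg ε]
  have hbound := norm_sq_le_of_slTrace_ne_two (ω := ω) (K := K + L + 5) hε.le (by lia)
    (show 2 ≤ L by lia) ((show L + 2 ≤ K + L + 5 + 1 by lia).trans (Nat.le_fib_self (by lia)))
    fun k hk => h k (by lia)
  rw [spec, Set.mem_ofPred_eq, spectrum.mem_iff, not_not, ← IsUnit.neg_iff, neg_sub]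
  have halg : algebraMap ℂ (EllTwo →L[ℂ] EllTwo) E =
    (E : ℂ) • ContinuousLinearMap.id ℂ EllTwo := Algebra.algebraMap_eq_smul_one _
  rw [halg]
  refine isUnit_of_isSymmetric_of_norm_le (c := L) (fun ψ φ => ?_) fun ψ => ?_
  · simp only [_root_.sub_apply, _root_.smul_apply,
      ContinuousLinearMap.id_apply, inner_sub_left, inner_sub_right, inner_hamiltonian,
      inner_smul_left, inner_smul_right, Complex.conj_ofReal]
  · have h1 := hbound ψ
    set y := ‖(hamiltonian V ω - (E : ℂ) • ContinuousLinearMap.id ℂ EllTwo) ψ‖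
    have h2 : ‖ψ‖ ^ 2 ≤ L * y ^ 2 := by nlinarith [sq_nonneg ‖ψ‖]
    have hL1 : (1 : ℝ) ≤ L := by push_cast [hL]; linarith [(Nat.cast_nonneg L₀ : (0 : ℝ) ≤ L₀)]
    have hy : 0 ≤ y := norm_nonneg _
    refine abs_le_of_sq_le_sq' ?_ (by simp; positivity) |>.2
    simp only [NNReal.coe_natCast]
    nlinarith [sq_nonneg y, mul_nonneg (sub_nonneg.2 hL1) (sq_nonneg y)]

/-! ### Trace bounds on the spectrum -/

lemma continuous_slTrace_wordMatrix (V : ℝ) (k : ℕ) :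
    Continuous fun E => slTrace (wordMatrix V E k) := by
  induction k using Nat.strong_induction_on with
  | _ k ih =>
    match k with
    | 0 => simp only [slTrace_wordMatrix_zero]; fun_prop
    | 1 => simp only [slTrace_wordMatrix_one]; fun_prop
    | 2 => simp only [slTrace_wordMatrix_two]; fun_prop
    | k + 3 =>
      simp only [slTrace_wordMatrix_add_three]
      exact ((ih _ (by lia)).mul (ih _ (by lia))).sub (ih _ (by lia))

/-- On the spectrum the traces do not escape. -/
lemma not_escape {V ω E : ℝ} (hE : E ∈ spec V ω) (k : ℕ)
    (h1 : 2 < |slTrace (wordMatrix V E (k + 1))|) (h2 : 2 < |slTrace (wordMatrix V E (k + 2))|)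
    (h0 : |slTrace (wordMatrix V E k)| <
      max |slTrace (wordMatrix V E (k + 1))| |slTrace (wordMatrix V E (k + 2))|) : False := by
  have c0 := (continuous_slTrace_wordMatrix V k).abs
  have c1 := (continuous_slTrace_wordMatrix V (k + 1)).abs
  have c2 := (continuous_slTrace_wordMatrix V (k + 2)).abs
  -- Escape is an open condition in the energy, so it persists near `E` and excludes trace 2 at all
  -- later levels.
  have hev := ((continuous_const.continuousAt.eventually_lt c1.continuousAt h1).and
    (continuous_const.continuousAt.eventually_lt c2.continuousAt h2)).and
      (c0.continuousAt.eventually_lt (c1.max c2).continuousAt h0)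
  obtain ⟨ε, hε, hball⟩ := Metric.eventually_nhds_iff.1 hev
  refine not_mem_spec hε (K := k + 1) (fun j hj E' hE' htr => ?_) hE
  obtain ⟨⟨a1, a2⟩, a0⟩ := hball (y := E') (by rwa [Real.dist_eq])
  have := two_lt_abs_slTrace a1 a2 a0 (j - (k + 1))
  rw [show k + (j - (k + 1)) + 1 = j by lia, htr] at this
  norm_num at this

lemma not_two_lt_and_two_lt {V ω E : ℝ} (hE : E ∈ spec V ω) (k : ℕ)
    (h0 : 2 < |slTrace (wordMatrix V E k)|) (h1 : 2 < |slTrace (wordMatrix V E (k + 1))|) :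
    False := by
  induction k with
  | zero =>
    -- The trace map extended one step back has initial value 2, which plays the role of the small
    -- preceding trace.
    have h2 : |slTrace (wordMatrix V E 1)| * |slTrace (wordMatrix V E 0)| - 2 ≤
        |slTrace (wordMatrix V E 2)| := by
      have := abs_sub_abs_le_abs_sub (E * (E - V)) 2
      rw [slTrace_wordMatrix_zero, slTrace_wordMatrix_one, slTrace_wordMatrix_two]
      rw [abs_mul, abs_two] at this
      linarith
    rw [zero_add] at h1
    refine not_escape hE 0 h1 ?_ (lt_max_of_lt_right ?_) <;> rw [zero_add] <;> nlinarith
  | succ k ih =>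
    refine not_escape hE k h0 h1 (lt_max_of_lt_left ?_)
    rcases le_or_gt |slTrace (wordMatrix V E k)| 2 with h | h
    · exact h.trans_lt h0
    · exact (ih h h0).elim

/-- Completing the square gives `(y - x z / 2)² = V² + (4 - x²)(4 - z²) / 4`, and the last term is
at most `(2 - |x z| / 2)²`. -/
lemma abs_le_of_invariant {V x y z : ℝ} (hV : 0 ≤ V) (hx : |x| ≤ 2) (hz : |z| ≤ 2)
    (h : x ^ 2 + y ^ 2 + z ^ 2 - x * y * z - 4 = V ^ 2) : |y| ≤ 2 + V := by
  by_contra! hy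
  have h1 : |x * y * z| = |x| * |y| * |z| := by rw [abs_mul, abs_mul]
  have h2 := le_abs_self (x * y * z)
  rw [h1] at h2
  rw [← sq_abs x, ← sq_abs y, ← sq_abs z] at h
  have hx0 := abs_nonneg x
  have hz0 := abs_nonneg z
  generalize |x| = a at *
  generalize |y| = b at *
  generalize |z| = c at *
  have h3 : a * c ≤ 4 := by nlinarith
  have h4 : V + (2 - a * c / 2) < b - a * c / 2 := by linarith
  have h5 : (V + (2 - a * c / 2)) ^ 2 < (b - a * c / 2) ^ 2 :=
    pow_lt_pow_left₀ h4 (by linarith) (by norm_num)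
  nlinarith [sq_nonneg (a - c), mul_nonneg hV (by linarith : 0 ≤ 2 - a * c / 2)]

/-- The traces over the standard words are bounded on the spectrum. -/
lemma abs_slTrace_wordMatrix_le {V ω E : ℝ} (hV : 0 ≤ V) (hE : E ∈ spec V ω) (k : ℕ)
    (hk : 1 ≤ k) : |slTrace (wordMatrix V E k)| ≤ 2 + V := by
  obtain ⟨k, rfl⟩ := Nat.exists_eq_add_of_le' hk
  rcases le_or_gt |slTrace (wordMatrix V E (k + 1))| 2 with h | h
  · linarith
  · refine abs_le_of_invariant hV ?_ ?_ (fricke_vogt V E k)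
    · by_contra! h'
      exact not_two_lt_and_two_lt hE k h' h
    · by_contra! h'
      exact not_two_lt_and_two_lt hE (k + 1) h h'

/-! ### Comparison of exponents and conclusion -/

lemma one_le_largestRoot {V : ℝ} (hV : 0 < V) : 1 ≤ largestRoot V := by
  have h := intermediate_value_Icc (f := fun x : ℝ => x ^ 3 - (2 + V) * x - 1)
    (show (1 : ℝ) ≤ 3 + V by linarith) (by fun_prop)
  obtain ⟨x, hx, hx0⟩ := h (show (0 : ℝ) ∈ _ by constructor <;> nlinarith [sq_nonneg V, pow_pos hV 3])
  exact hx.1.trans ((isGreatest_largestRoot hV).2 hx0)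

lemma three_add_le {V : ℝ} (hV : 0 < V) :
    3 + V ≤ (5 + 2 * V) ^ (1 / 2 : ℝ) * (3 + V) * largestRoot V := by
  have h1 : 1 ≤ (5 + 2 * V) ^ (1 / 2 : ℝ) := Real.one_le_rpow (by linarith) (by norm_num)
  have h2 : 1 ≤ (5 + 2 * V) ^ (1 / 2 : ℝ) * largestRoot V :=
    one_le_mul_of_one_le_of_one_le h1 (one_le_largestRoot hV)
  nlinarith

lemma goldenRatio_pow_le_fib (k : ℕ) : Real.goldenRatio ^ k ≤ Nat.fib (k + 2) := by
  have h := Real.goldenRatio_mul_fib_succ_add_fib k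
  have h1 := Real.fib_succ_sub_goldenConj_mul_fib k
  have h2 : (Nat.fib (k + 2) : ℝ) = Nat.fib k + Nat.fib (k + 1) := by
    exact_mod_cast Nat.fib_add_two (n := k)
  nlinarith [Real.neg_one_lt_goldenConj, (Nat.cast_nonneg _ : (0 : ℝ) ≤ Nat.fib k)]

lemma entrySum_transferMatrix_le {V E b : ℝ} {ω : ℝ} {n m : ℤ} {N : ℕ} (hnm : |n - m| ≤ (N : ℤ))
    (h : ∀ (m : ℤ) (k : ℕ), k ≤ N → entrySum (stepProd V ω E m k) ≤ b) :
    entrySum (transferMatrix V n m ω E) ≤ b := by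
  rw [abs_le] at hnm
  unfold transferMatrix
  split_ifs with hle
  · exact h _ _ (by lia)
  · rw [entrySum_inv]
    exact h _ _ (by lia)

end Fibonacci

theorem theoremt (V : ℝ) (hV : 0 < V) (ζ : ℝ)
    (hζ : Real.log ((5 + 2 * V) ^ (1 / 2 : ℝ) * (3 + V) * Fibonacci.largestRoot V) /
      Real.log ((√5 + 1) / 2) < ζ) :
    ∃ C : ℝ, 0 < C ∧ ∀ ω ω' : ℝ, ∀ E ∈ Fibonacci.spec V ω', ∀ N : ℕ, 1 ≤ N →
      ∀ n m : ℤ, |n - m| ≤ (N : ℤ) →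
        Fibonacci.opNorm (Fibonacci.transferMatrix V n m ω E) ≤ C * (N : ℝ) ^ ζ := by
  obtain ⟨K, hK, hop⟩ := Fibonacci.exists_opNorm_le
  have hφ : (√5 + 1) / 2 = Real.goldenRatio := by rw [Real.goldenRatio, add_comm]
  have hlog : 0 < Real.log Real.goldenRatio := Real.log_pos Real.one_lt_goldenRatio
  rw [hφ] at hζ
  have hζ' : Real.log (3 + V) / Real.log Real.goldenRatio ≤ ζ := by
    refine le_trans ?_ hζ.le
    gcongr
    exact Fibonacci.three_add_le hV
  set B : ℝ := 2 * (4 * V + 4) ^ 5 with hB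
  have hB0 : 0 < B := by positivity
  refine ⟨K * (B * (3 + V)), by positivity, fun ω ω' E hE N hN n m hnm => ?_⟩
  have hN1 : (1 : ℝ) ≤ N := by exact_mod_cast hN
  have hlogN : 0 ≤ Real.log N := Real.log_nonneg hN1
  set k := ⌈Real.log N / Real.log Real.goldenRatio⌉₊ with hk
  have hk1 : Real.log N ≤ k * Real.log Real.goldenRatio := by
    rw [← div_le_iff₀ hlog]
    exact Nat.le_ceil _
  have hk2 : (k : ℝ) ≤ Real.log N / Real.log Real.goldenRatio + 1 :=
    (Nat.ceil_lt_add_one (by positivity)).le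
  have hNk : N ≤ Nat.fib (k + 5) := by
    refine le_trans ?_ (Nat.fib_mono (show k + 2 ≤ k + 5 by lia))
    have h1 : (N : ℝ) ≤ Real.goldenRatio ^ k := by
      rw [← Real.log_le_log_iff (by linarith) (pow_pos Real.goldenRatio_pos _), Real.log_pow]
      exact hk1
    exact_mod_cast h1.trans (Fibonacci.goldenRatio_pow_le_fib k)
  -- The phase `ω'` serves only to bound traces that depend on `E` alone, so `ω` may differ from it
  -- without appeal to phase-independence of the spectrum.
  have hmain := Fibonacci.entrySum_transferMatrix_le (V := V) (E := E) (ω := ω) hnm fun m j hj =>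
    Fibonacci.entrySum_stepProd_le_pow hV.le
      (Fibonacci.abs_slTrace_wordMatrix_le hV.le hE) ω k m j (hj.trans hNk)
  have hlogV : 0 ≤ Real.log (3 + V) := Real.log_nonneg (by linarith)
  -- The extra factor `3 + V` pays for rounding `log N / log φ` up to `k`.
  have hpow : (3 + V) ^ k ≤ (3 + V) * (N : ℝ) ^ ζ := by
    rw [← Real.log_le_log_iff (by positivity) (by positivity), Real.log_pow,
      Real.log_mul (by positivity) (by positivity), Real.log_rpow (by linarith)]
    calc k * Real.log (3 + V)
        ≤ (Real.log N / Real.log Real.goldenRatio + 1) * Real.log (3 + V) := by gcongr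
      _ = Real.log (3 + V) + Real.log (3 + V) / Real.log Real.goldenRatio * Real.log N := by ring
      _ ≤ Real.log (3 + V) + ζ * Real.log N := by gcongr
  calc Fibonacci.opNorm (Fibonacci.transferMatrix V n m ω E)
      ≤ K * (B * (3 + V) ^ k) := (hop _).trans (by gcongr)
    _ ≤ K * (B * ((3 + V) * (N : ℝ) ^ ζ)) := by gcongr
    _ = K * (B * (3 + V)) * (N : ℝ) ^ ζ := by ring
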